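/- Let $S,S'$ be finite sets of points in $\mathbb{R}^2$, let $\mathcal{H}$ be a finite set of closed halfplanes, let $k\ge 1$ be an integer, and let $p\in\mathbb{R}^2$ be a point contained in no halfplane of $\mathcal{H}$ (in particular $p$ lies in the interior of a face of the arrangement of the boundary lines of $\mathcal{H}$). For nonzero vectors $\vec u,\vec v$ let $\mathsf{ang}(\vec u,\vec v)\in[0,2\pi)$ denote the clockwise ordered angle from $\vec u$ to $\vec v$. **Polygons.** A (bounded, nondegenerate) convex polygon $\varGamma$ is *$\mathcal{H}$-compatible* if each edge $e$ of $\varGamma$ lies on the boundary line of some halfplane $H(e)\in\mathcal{H}$ with $\varGamma\cap H(e)=e$. An $\mathcal{H}$-compatible $\varGamma$ is *well-behaved* if (i) no point of $S$ lies in the interior of $\varGamma$, and (ii) $\bigl(\bigcap_{i=1}^{k+1}H(e_i)\bigr)\cap S'=\emptyset$ for any $k+1$ consecutive edges $e_1,\dots,e_{k+1}$ of $\varGamma$ in the cyclic order (wrapping around if $\varGamma$ has fewer than $k+1$ edges). **Graph.** Let $\mathcal{L}$ be the set of boundary lines of the halfplanes in $\mathcal{H}$, and let $\varPhi$ be the set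 of nondegenerate segments that lie on some $\ell\in\mathcal{L}$ and each of whose endpoints is the intersection point of $\ell$ with another line of $\mathcal{L}$. For $\phi\in\varPhi$ let $\Delta_\phi$ be the triangle formed by $p$ and the endpoints of $\phi$; call the endpoints $a,b$ of $\phi$ the left and the right endpoint, respectively, if $p\to a\to b$ is the clockwise order of the vertices of $\Delta_\phi$; and let $H(\phi)$ be the (unique) halfplane of $\mathcal{H}$ whose boundary line contains $\phi$. The vertices of the directed graph $G$ are the tuples $(\phi_0,\dots,\phi_k)\in\varPhi^{k+1}$ such that 1. the left endpoint of $\phi_i$ is the right endpoint of $\phi_{i-1}$ for $1\le i\le k$; 2. $\mathsf{ang}(\overrightarrow{a_{i-1}a_i},\overrightarrow{a_ia_{i+1}})\le\pi$ for $1\le i\le k$, where $a_i$ is the left endpoint of $\phi_i$ for $0\le i\le k$ and $a_{k+1}$ is the right endpoint of $\phi_k$; 3. $S\cap\bigcup_{i=0}^k\Delta_{\phi_i}\subseteq\bigcup_{i=0}^k\phi_i$ and $\bigl(\bigcap_{i=0}^kH(\phi_i)\bigr)\cap S'=\emptyset$. There is an edge from $(\phi_0,\dots,\phi_k)$ to $(\phi'_0,\dots,\phi'_k)$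 whenever $(\phi_1,\dots,\phi_k)=(\phi'_0,\dots,\phi'_{k-1})$; its weight is $\mathsf{ang}(\overrightarrow{pa},\overrightarrow{pb})$, where $a$ and $b$ are the left endpoints of $\phi_0$ and of $\phi'_0$. **Claim.** There exists a well-behaved $\mathcal{H}$-compatible convex polygon containing $p$ if and only if the weighted length of a shortest directed cycle of $G$ is exactly $2\pi$ (that is, $G$ has a directed cycle of length $2\pi$ and none of smaller length). -/

import Mathlib

noncomputable section

namespace HalfplaneCover

/-- The Euclidean plane. -/
abbrev Plane : Type := EuclideanSpace ℝ (Fin 2)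

/-! ### Angles and halfplanes -/

/-- A plane vector as a complex number. -/
def toC (u : Plane) : ℂ := ⟨u 0, u 1⟩

/-- The clockwise ordered angle from `u` to `v` (both nonzero), as a number in `[0, 2π)`:
rotating `u` clockwise by this angle gives the direction of `v`. -/
def ang (u v : Plane) : ℝ :=
  toIcoMod Real.two_pi_pos 0 (Complex.arg (toC u / toC v))

/-- The cross product of two plane vectors; it is negative iff `v` points strictly to the right
of the direction `u`. -/
def cross (u v : Plane) : ℝ := u 0 * v 1 - u 1 * v 0

/-- A closed halfplane `a x + b y + c ≥ 0` with `a² + b² = 1`; the normalization makes the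
coefficients unique. -/
structure HalfPlane where
  a : ℝ
  b : ℝ
  c : ℝ
  unit : a ^ 2 + b ^ 2 = 1

/-- The points of a halfplane. -/
def HalfPlane.carrier (H : HalfPlane) : Set Plane := {x | 0 ≤ H.a * x 0 + H.b * x 1 + H.c}

/-- The boundary line of a halfplane. -/
def HalfPlane.line (H : HalfPlane) : Set Plane := {x | H.a * x 0 + H.b * x 1 + H.c = 0}

/-- The set of boundary lines of the halfplanes in `ℋ`. -/
def boundaryLines (ℋ : Finset HalfPlane) : Set (Set Plane) := {ℓ | ∃ H ∈ ℋ, ℓ = H.line}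

/-! ### Convex polygons -/

/-- A (bounded, nondegenerate) convex polygon, given by its vertices in clockwise order, indexed
cyclically: there are at least three, and all vertices other than the two endpoints of an edge
lie strictly to the right of that edge. -/
structure ConvexPolygon where
  n : ℕ
  three_le : 3 ≤ n
  vertex : ZMod n → Plane
  convex : ∀ i j : ZMod n, j ≠ i → j ≠ i + 1 →
    cross (vertex (i + 1) - vertex i) (vertex j - vertex i) < 0

namespace ConvexPolygon

/-- The region of the polygon. -/
def region (Γ : ConvexPolygon) : Set Plane := convexHull ℝ (Set.range Γ.vertex)

/-- The `i`-th edge of the polygon, in clockwise order. -/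
def edge (Γ : ConvexPolygon) (i : ZMod Γ.n) : Set Plane :=
  segment ℝ (Γ.vertex i) (Γ.vertex (i + 1))

/-- `H` is a halfplane of `ℋ` that plays the role of `H(e)` for the `i`-th edge `e` of `Γ`: the
edge lies on the boundary line of `H`, and `Γ ∩ H = e`. -/
def IsEdgeHalfplane (Γ : ConvexPolygon) (ℋ : Finset HalfPlane) (i : ZMod Γ.n)
    (H : HalfPlane) : Prop :=
  H ∈ ℋ ∧ Γ.edge i ⊆ H.line ∧ Γ.region ∩ H.carrier = Γ.edge i

/-- `ℋ`-compatibility. -/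
def Compatible (Γ : ConvexPolygon) (ℋ : Finset HalfPlane) : Prop :=
  ∀ i : ZMod Γ.n, ∃ H : HalfPlane, Γ.IsEdgeHalfplane ℋ i H

/-- `Γ` is well-behaved: no point of `S` lies in its interior, and for any `k + 1` consecutive
edges (in the cyclic order) `⋂ H(eⱼ)` contains no point of `S'`. The halfplane `H(e)` is
determined by `e`, so that ranging over all `H` with `IsEdgeHalfplane` just names it. -/
def WellBehaved (Γ : ConvexPolygon) (S S' : Finset Plane) (ℋ : Finset HalfPlane) (k : ℕ) :
    Prop :=
  (∀ s ∈ S, s ∉ interior Γ.region) ∧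
  ∀ (i : ZMod Γ.n) (H : Fin (k + 1) → HalfPlane),
    (∀ j : Fin (k + 1), Γ.IsEdgeHalfplane ℋ (i + ((j : ℕ) : ZMod Γ.n)) (H j)) →
    (⋂ j, (H j).carrier) ∩ (S' : Set Plane) = ∅

end ConvexPolygon

/-! ### Segments and chains -/

/-- A segment, recorded by its left and its right endpoint (as seen from the base point). -/
@[ext]
structure Seg where
  left : Plane
  right : Plane

namespace Seg

/-- The points of a segment. -/
def carrier (φ : Seg) : Set Plane := segment ℝ φ.left φ.right

/-- The vector from the left to the right endpoint. -/
def dir (φ : Seg) : Plane := φ.right - φ.left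

/-- The (solid) triangle spanned by `p` and the segment. -/
def triangle (p : Plane) (φ : Seg) : Set Plane := convexHull ℝ {p, φ.left, φ.right}

end Seg

/-- The set `Φ` of segments lying on a line `ℓ` of the arrangement, each of whose two endpoints is
the intersection point of `ℓ` with another line of the arrangement. The last condition says that
`p → left → right` is clockwise; when `p` is on no line of the arrangement it just chooses which
endpoint of a nondegenerate segment is called left. -/
def segments (ℋ : Finset HalfPlane) (p : Plane) : Set Seg :=
  {φ | (∃ ℓ ∈ boundaryLines ℋ,
          (∃ ℓ' ∈ boundaryLines ℋ, ℓ ∩ ℓ' = {φ.left}) ∧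
          (∃ ℓ' ∈ boundaryLines ℋ, ℓ ∩ ℓ' = {φ.right})) ∧
        cross (φ.left - p) (φ.right - p) < 0}

/-- The three conditions on a `(k + 1)`-tuple of segments of `Φ` that define the vertices of the
graph. In the last one, `H j` is the halfplane of `ℋ` whose boundary line contains the `j`-th
segment (there is only one when no halfplane of `ℋ` contains `p`). -/
structure IsChain (S S' : Finset Plane) (ℋ : Finset HalfPlane) (p : Plane) (k : ℕ)
    (φ : Fin (k + 1) → Seg) : Prop where
  mem : ∀ i, φ i ∈ segments ℋ p
  chain : ∀ i : Fin k, (φ i.succ).left = (φ i.castSucc).right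
  convex : ∀ i : Fin k, ang (φ i.castSucc).dir (φ i.succ).dir ≤ Real.pi
  coverage : (S : Set Plane) ∩ (⋃ i, (φ i).triangle p) ⊆ ⋃ i, (φ i).carrier
  membership : ∀ H : Fin (k + 1) → HalfPlane,
    (∀ j, H j ∈ ℋ ∧ (φ j).carrier ⊆ (H j).line) →
    (⋂ j, (H j).carrier) ∩ (S' : Set Plane) = ∅

/-! ### The weighted directed graph -/

/-- The vertices of `G`. -/
def Vert (S S' : Finset Plane) (ℋ : Finset HalfPlane) (p : Plane) (k : ℕ) : Type :=
  {φ : Fin (k + 1) → Seg // IsChain S S' ℋ p k φ}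

/-- The directed graph `G`: there is an edge from `(φ₀, …, φₖ)` to `(φ₀', …, φₖ')` when
`(φ₁, …, φₖ) = (φ₀', …, φₖ₋₁')`. -/
def chainGraph (S S' : Finset Plane) (ℋ : Finset HalfPlane) (p : Plane) (k : ℕ) :
    Digraph (Vert S S' ℋ p k) where
  Adj v v' := ∀ i : Fin k, v.1 i.succ = v'.1 i.castSucc

/-- The weight of the edge from `v` to `v'`: the clockwise angle at `p` from the left endpoint of
`φ₀` to the left endpoint of `φ₀'`. -/
def weight {S S' : Finset Plane} {ℋ : Finset HalfPlane} {p : Plane} {k : ℕ}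
    (v v' : Vert S S' ℋ p k) : ℝ :=
  ang ((v.1 0).left - p) ((v'.1 0).left - p)

/-- `v 0, v 1, …, v r = v 0` is a directed cycle of `G` with `r ≥ 1` edges (values of `v` beyond
`r` play no role). -/
structure IsDirectedCycle {V : Type*} (G : Digraph V) (r : ℕ) (v : ℕ → V) : Prop where
  pos : 0 < r
  closed : v r = v 0
  adj : ∀ i < r, G.Adj (v i) (v (i + 1))
  inj : Set.InjOn v (Set.Iio r)

/-- The set of weighted lengths of the directed cycles of `G`. -/
def cycleLengths {V : Type*} (G : Digraph V) (w : V → V → ℝ) : Set ℝ :=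
  {L | ∃ (r : ℕ) (v : ℕ → V), IsDirectedCycle G r v ∧
        L = ∑ i ∈ Finset.range r, w (v i) (v (i + 1))}

end HalfplaneCover

end

/-!
Everything is seen from the point `p`. A closed walk `z` in the plane, each step of which goes
clockwise around the origin (`ClockwiseLoop`), has an accumulated angle `cumAngle`, in terms of
which its points are known in polar form. The angle gained in one period is a positive multiple of
`2π`. The left endpoints of the segments of a directed cycle form such a walk, and its weighted
length is this angle, so no cycle is shorter than `2π`.

*From polygons to cycles.* The vertices of a polygon form such a walk, too. It has only one turn
(`ConvexPolygon.StrictlyInside.cumAngle_corner`): in a second turn some edge would cross the ray from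
`p` through the first vertex, in conflict with convexity. Hence the runs of `k + 1` consecutive edges
form a cycle of length `2π`; they are vertices of the graph because the triangle spanned by `p` and
an edge has only the edge in common with the boundary, and because a halfplane of `ℋ` bounded by the
line of an edge meets the polygon only in this edge, as it avoids `p`.

*From cycles to polygons.* A cycle of length `2π` is a walk with one turn that never bends to the
left (`ConvexLoop`). Let the linear form `stepForm z m` be `1` on the line of the `m`-th step. Forms
of successive steps differ by a nonpositive multiple of `cross (z (m + 1))`, which has constant sign
on the points of the walk up to half a turn ahead, and the opposite sign up to half a turn behind.
Therefore all points of the walk are on the near side of every line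
(`ConvexLoop.stepForm_le_one`, and `ConvexLoop.stepForm_lt_one` for strictness). The points where
the walk really bends are then the vertices of a convex polygon (`ConvexLoop.polygon`). Each of its
points is in one of the triangles of the cycle, so the coverage conditions keep `S` out of the
interior. Given `k + 1` consecutive edges, the `k + 1` segments that start with the last segment in
the first edge lie in these edges, so the membership condition for `S'` carries over.
-/

namespace HalfplaneCover

/-! ### Cross products and clockwise angles -/

lemma cross_ne_left {u v : Plane} (h : cross u v < 0) : u ≠ 0 := by
  rintro rfl
  simp [cross] at h

lemma cross_ne_right {u v : Plane} (h : cross u v < 0) : v ≠ 0 := by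
  rintro rfl
  simp [cross] at h

lemma toC_ne_zero {u : Plane} (h : u ≠ 0) : toC u ≠ 0 := by
  intro h0
  apply h
  have h1 := congrArg Complex.re h0
  have h2 := congrArg Complex.im h0
  ext i
  fin_cases i
  · simpa [toC] using h1
  · simpa [toC] using h2

lemma ang_nonneg (u v : Plane) : 0 ≤ ang u v :=
  (toIcoMod_mem_Ico Real.two_pi_pos 0 _).1

lemma ang_lt_two_pi (u v : Plane) : ang u v < 2 * Real.pi := by
  have := (toIcoMod_mem_Ico Real.two_pi_pos 0 (Complex.arg (toC u / toC v))).2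
  rwa [zero_add] at this

/-- The clockwise angle `ang u v` is the amount by which the direction of `u` has to be turned
clockwise to become the direction of `v`. -/
lemma toC_eq_of_ang {u v : Plane} (hu : u ≠ 0) (hv : v ≠ 0) {θ : ℝ}
    (h : toC u = ‖toC u‖ * Complex.exp (-θ * Complex.I)) :
    toC v = ‖toC v‖ * Complex.exp (-(θ + ang u v : ℝ) * Complex.I) := by
  have hu' := toC_ne_zero hu
  have hv' := toC_ne_zero hv
  set w := toC u / toC v with hw
  have hang : ang u v = Complex.arg w - toIcoDiv Real.two_pi_pos 0 (Complex.arg w) • (2 * Real.pi) :=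
    rfl
  have h1 : toC u = w * toC v := by rw [hw]; field_simp
  have h2 : w = (‖toC u‖ / ‖toC v‖ : ℝ) * Complex.exp (Complex.arg w * Complex.I) := by
    have := (Complex.norm_mul_exp_arg_mul_I w).symm
    rwa [show ‖w‖ = ‖toC u‖ / ‖toC v‖ by rw [hw, norm_div]] at this
  have h3 : Complex.exp (-(θ + ang u v : ℝ) * Complex.I) * Complex.exp (Complex.arg w * Complex.I)
      = Complex.exp (-θ * Complex.I) := by
    rw [← Complex.exp_add, hang]
    have : (-((θ + (Complex.arg w - toIcoDiv Real.two_pi_pos 0 (Complex.arg w) • (2 * Real.pi)) : ℝ)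
        : ℂ) * Complex.I + Complex.arg w * Complex.I)
        = -θ * Complex.I
          + (toIcoDiv Real.two_pi_pos 0 (Complex.arg w) : ℤ) * (2 * Real.pi * Complex.I) := by
      push_cast [zsmul_eq_mul]
      ring
    rw [this, Complex.exp_add, Complex.exp_int_mul_two_pi_mul_I, mul_one]
  have nu : (‖toC u‖ : ℂ) ≠ 0 := by simpa using hu'
  have nv : (‖toC v‖ : ℂ) ≠ 0 := by simpa using hv'
  have e0 := Complex.exp_ne_zero (Complex.arg w * Complex.I)
  rw [h1] at h
  rw [← h3] at h
  rw [norm_mul] at h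
  have h4 : ‖w‖ = ‖toC u‖ / ‖toC v‖ := by rw [hw, norm_div]
  have h5 : w * toC v = (‖toC u‖ / ‖toC v‖ : ℝ) * Complex.exp (Complex.arg w * Complex.I) * toC v := by
    rw [← h2]
  rw [h5, h4] at h
  push_cast at h
  have h6 : ((‖toC u‖ : ℂ) / ‖toC v‖ * Complex.exp (Complex.arg w * Complex.I)) ≠ 0 :=
    mul_ne_zero (div_ne_zero nu nv) e0
  apply mul_left_cancel₀ h6
  rw [h]
  push_cast
  ring

/-- Coordinates of a plane vector given in polar form, angles being measured clockwise. -/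
lemma coord_of_polar {u : Plane} {θ ρ : ℝ} (h : toC u = ρ * Complex.exp (-θ * Complex.I)) :
    u 0 = ρ * Real.cos θ ∧ u 1 = -(ρ * Real.sin θ) := by
  have h1 : Complex.exp (-θ * Complex.I) = ⟨Real.cos θ, -Real.sin θ⟩ := by
    rw [← Complex.ofReal_neg, Complex.exp_mul_I]
    apply Complex.ext
    · simp [← Complex.ofReal_cos, ← Complex.ofReal_sin]
    · simp [← Complex.ofReal_cos, ← Complex.ofReal_sin]
  rw [h1] at h
  constructor
  · simpa [toC] using congrArg Complex.re h
  · simpa [toC] using congrArg Complex.im h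

lemma toC_polar (u : Plane) :
    toC u = ‖toC u‖ * Complex.exp (-((-Complex.arg (toC u) : ℝ) : ℂ) * Complex.I) := by
  simp

lemma cross_eq_sin_ang {u v : Plane} (hu : u ≠ 0) (hv : v ≠ 0) :
    cross u v = -(‖toC u‖ * ‖toC v‖ * Real.sin (ang u v)) := by
  obtain ⟨a1, a2⟩ := coord_of_polar (toC_polar u)
  obtain ⟨b1, b2⟩ := coord_of_polar (toC_eq_of_ang hu hv (toC_polar u))
  simp only [cross, a1, a2, b1, b2, Real.sin_add, Real.cos_add]
  have := Real.sin_sq_add_cos_sq (-Complex.arg (toC u))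
  linear_combination (-(‖toC u‖ * ‖toC v‖ * Real.sin (ang u v))) * this

lemma ang_mem_of_cross_neg {u v : Plane} (h : cross u v < 0) :
    0 < ang u v ∧ ang u v < Real.pi := by
  have hu := cross_ne_left h
  have hv := cross_ne_right h
  have hs : 0 < Real.sin (ang u v) := by
    rw [cross_eq_sin_ang hu hv, neg_lt_zero] at h
    exact pos_of_mul_pos_right h (by positivity)
  constructor
  · rcases (ang_nonneg u v).eq_or_lt with h0 | h0
    · rw [← h0] at hs
      simp at hs
    · exact h0
  · by_contra! hge
    have : 0 ≤ Real.sin (ang u v - Real.pi) :=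
      Real.sin_nonneg_of_nonneg_of_le_pi (by linarith) (by linarith [ang_lt_two_pi u v])
    rw [Real.sin_sub_pi] at this
    linarith

lemma cross_nonpos_of_ang_le {u v : Plane} (hu : u ≠ 0) (hv : v ≠ 0) (h : ang u v ≤ Real.pi) :
    cross u v ≤ 0 := by
  rw [cross_eq_sin_ang hu hv, neg_nonpos]
  have := Real.sin_nonneg_of_nonneg_of_le_pi (ang_nonneg u v) h
  positivity

/-! ### The linear form of a line -/

/-- The linear form that is `1` on the line through `u` and `v`, for `u`, `v` linearly
independent. -/
noncomputable def lineForm (u v : Plane) : Plane →ₗ[ℝ] ℝ where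
  toFun x := (cross x v + cross u x) / cross u v
  map_add' x y := by simp only [cross, PiLp.add_apply]; ring
  map_smul' c x := by simp only [cross, PiLp.smul_apply, smul_eq_mul, RingHom.id_apply]; ring

lemma lineForm_apply (u v x : Plane) :
    lineForm u v x = (cross x v + cross u x) / cross u v := rfl

lemma cross_self (u : Plane) : cross u u = 0 := by simp only [cross]; ring

lemma lineForm_left {u v : Plane} (h : cross u v ≠ 0) : lineForm u v u = 1 := by
  rw [lineForm_apply, cross_self, add_zero, div_self h]

lemma lineForm_right {u v : Plane} (h : cross u v ≠ 0) : lineForm u v v = 1 := by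
  rw [lineForm_apply, cross_self, zero_add, div_self h]

lemma cross_smul_eq (u v x : Plane) : cross u v • x = cross x v • u + cross u x • v := by
  ext i
  fin_cases i <;> simp [cross] <;> ring

/-- A linear form that is `1` at two independent vectors is the form of the line through them. -/
lemma eq_lineForm {u v : Plane} (h : cross u v ≠ 0) {f : Plane →ₗ[ℝ] ℝ} (hu : f u = 1)
    (hv : f v = 1) : f = lineForm u v := by
  ext1 x
  have := congrArg f (cross_smul_eq u v x)
  simp only [map_add, map_smul, smul_eq_mul, hu, hv, mul_one] at this
  rw [lineForm_apply, ← this]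
  field_simp

/-- The line form measures on which side of the directed edge from `u` to `v` a point lies. -/
lemma cross_sub_eq_lineForm {u v : Plane} (h : cross u v ≠ 0) (x : Plane) :
    cross (v - u) (x - u) = cross u v * (1 - lineForm u v x) := by
  rw [lineForm_apply, mul_sub, mul_div_cancel₀ _ h]
  simp only [cross, PiLp.sub_apply]
  ring

/-- Turning at `v`: the forms of two lines through `v` differ by a multiple of `cross v`. -/
lemma lineForm_sub_lineForm {u v w : Plane} (huv : cross u v ≠ 0) (hvw : cross v w ≠ 0)
    (x : Plane) : lineForm v w x - lineForm u v x =
      cross (v - u) (w - v) / (cross u v * cross v w) * cross v x := by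
  rw [lineForm_apply, lineForm_apply]
  field_simp
  simp only [cross, PiLp.sub_apply]
  ring

/-! ### Closed clockwise walks around the origin -/

/-- A closed walk of period `r` that goes clockwise around the origin in every step. -/
structure ClockwiseLoop (r : ℕ) (z : ℕ → Plane) : Prop where
  pos : 0 < r
  periodic : ∀ m, z (m + r) = z m
  turn : ∀ m, cross (z m) (z (m + 1)) < 0

/-- The accumulated clockwise angle of a walk, starting with the clockwise argument of its first
point. -/
noncomputable def cumAngle (z : ℕ → Plane) (m : ℕ) : ℝ :=
  -Complex.arg (toC (z 0)) + ∑ i ∈ Finset.range m, ang (z i) (z (i + 1))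

lemma cumAngle_succ (z : ℕ → Plane) (m : ℕ) :
    cumAngle z (m + 1) = cumAngle z m + ang (z m) (z (m + 1)) := by
  rw [cumAngle, cumAngle, Finset.sum_range_succ, add_assoc]

lemma sum_ang_eq (z : ℕ → Plane) (m : ℕ) :
    ∑ i ∈ Finset.range m, ang (z i) (z (i + 1)) = cumAngle z m - cumAngle z 0 := by
  simp [cumAngle]

/-- Discrete intermediate value theorem. -/
lemma exists_step {α : Type*} [LinearOrder α] (f : ℕ → α) (x : α) (b : ℕ) (h0 : f 0 ≤ x)
    (hb : x < f b) : ∃ a < b, f a ≤ x ∧ x < f (a + 1) := by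
  induction b with
  | zero => exact absurd hb (not_lt.2 h0)
  | succ b ih =>
    by_cases h : x < f b
    · obtain ⟨a, ha, h'⟩ := ih h
      exact ⟨a, by omega, h'⟩
    · exact ⟨b, by omega, not_lt.1 h, hb⟩

namespace ClockwiseLoop

variable {r : ℕ} {z : ℕ → Plane}

lemma ne_zero (h : ClockwiseLoop r z) (m : ℕ) : z m ≠ 0 := cross_ne_left (h.turn m)

lemma polar (h : ClockwiseLoop r z) (m : ℕ) :
    toC (z m) = ‖toC (z m)‖ * Complex.exp (-(cumAngle z m : ℝ) * Complex.I) := by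
  induction m with
  | zero => simp [cumAngle]
  | succ m ih =>
    rw [cumAngle_succ]
    exact toC_eq_of_ang (h.ne_zero m) (h.ne_zero (m + 1)) ih

lemma coord (h : ClockwiseLoop r z) (m : ℕ) :
    z m 0 = ‖toC (z m)‖ * Real.cos (cumAngle z m) ∧
      z m 1 = -(‖toC (z m)‖ * Real.sin (cumAngle z m)) :=
  coord_of_polar (h.polar m)

lemma norm_pos (h : ClockwiseLoop r z) (m : ℕ) : 0 < ‖toC (z m)‖ :=
  norm_pos_iff.2 (toC_ne_zero (h.ne_zero m))

lemma cross_eq (h : ClockwiseLoop r z) (i j : ℕ) : cross (z i) (z j) =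
    -(‖toC (z i)‖ * ‖toC (z j)‖ * Real.sin (cumAngle z j - cumAngle z i)) := by
  rw [Real.sin_sub, cross, (h.coord i).1, (h.coord i).2, (h.coord j).1, (h.coord j).2]
  ring

lemma lt_succ (h : ClockwiseLoop r z) (m : ℕ) : cumAngle z m < cumAngle z (m + 1) := by
  rw [cumAngle_succ]
  linarith [(ang_mem_of_cross_neg (h.turn m)).1]

lemma succ_lt (h : ClockwiseLoop r z) (m : ℕ) :
    cumAngle z (m + 1) < cumAngle z m + Real.pi := by
  rw [cumAngle_succ]
  linarith [(ang_mem_of_cross_neg (h.turn m)).2]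

lemma strictMono (h : ClockwiseLoop r z) : StrictMono (cumAngle z) :=
  strictMono_nat_of_lt_succ h.lt_succ

lemma cumAngle_add (h : ClockwiseLoop r z) (m : ℕ) :
    cumAngle z (m + r) = cumAngle z m + (cumAngle z r - cumAngle z 0) := by
  induction m with
  | zero => simp
  | succ m ih =>
    rw [show m + 1 + r = (m + r) + 1 by ring, cumAngle_succ, ih, cumAngle_succ, h.periodic,
      show m + r + 1 = (m + 1) + r by ring, h.periodic]
    ring

/-- A closed walk has accumulated a positive multiple of the full angle. -/
lemma exists_winding (h : ClockwiseLoop r z) :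
    ∃ c : ℕ, 1 ≤ c ∧ cumAngle z r - cumAngle z 0 = c * (2 * Real.pi) := by
  have hp := Real.pi_pos
  have hlt := h.strictMono h.pos
  have h0 := h.polar 0
  have hr := h.polar r
  have hzr : z r = z 0 := by simpa using h.periodic 0
  rw [hzr] at hr
  have hn : (‖toC (z 0)‖ : ℂ) ≠ 0 := by exact_mod_cast (h.norm_pos 0).ne'
  have he := mul_left_cancel₀ hn (h0.symm.trans hr)
  obtain ⟨c, hc⟩ := Complex.exp_eq_exp_iff_exists_int.1 he
  have hc' : cumAngle z r - cumAngle z 0 = c * (2 * Real.pi) := by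
    have := congrArg Complex.im hc
    simp at this
    linarith
  have hcpos : (0 : ℝ) < c := by
    by_contra! hneg
    nlinarith
  have hc0 : 0 < c := by exact_mod_cast hcpos
  lift c to ℕ using hc0.le
  exact ⟨c, by exact_mod_cast hc0, by exact_mod_cast hc'⟩

lemma two_pi_le (h : ClockwiseLoop r z) : 2 * Real.pi ≤ cumAngle z r - cumAngle z 0 := by
  obtain ⟨c, hc, he⟩ := h.exists_winding
  rw [he]
  have : (1 : ℝ) ≤ c := by exact_mod_cast hc
  nlinarith [Real.pi_pos]

/-- A vector whose direction lies between those of two points of the walk less than a half turn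
apart is in the cone spanned by these points. -/
lemma exists_cone (h : ClockwiseLoop r z) {i j : ℕ} {x : Plane} {ρ θ : ℝ} (hρ : 0 ≤ ρ)
    (h0 : x 0 = ρ * Real.cos θ) (h1 : x 1 = -(ρ * Real.sin θ)) (hi : cumAngle z i ≤ θ)
    (hj : θ ≤ cumAngle z j) (hij : cumAngle z i < cumAngle z j)
    (hπ : cumAngle z j < cumAngle z i + Real.pi) :
    ∃ α β : ℝ, 0 ≤ α ∧ 0 ≤ β ∧ x = α • z i + β • z j := by
  have hs : 0 < Real.sin (cumAngle z j - cumAngle z i) :=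
    Real.sin_pos_of_pos_of_lt_pi (by linarith) (by linarith)
  have hs1 : 0 ≤ Real.sin (cumAngle z j - θ) :=
    Real.sin_nonneg_of_nonneg_of_le_pi (by linarith) (by linarith)
  have hs2 : 0 ≤ Real.sin (θ - cumAngle z i) :=
    Real.sin_nonneg_of_nonneg_of_le_pi (by linarith) (by linarith)
  have hni := h.norm_pos i
  have hnj := h.norm_pos j
  -- the sine rule in the triangle cut out by the three directions
  refine ⟨ρ * Real.sin (cumAngle z j - θ) / (‖toC (z i)‖ * Real.sin (cumAngle z j - cumAngle z i)),
    ρ * Real.sin (θ - cumAngle z i) / (‖toC (z j)‖ * Real.sin (cumAngle z j - cumAngle z i)),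
    by positivity, by positivity, ?_⟩
  have hc := cross_smul_eq (z i) (z j) x
  have hcij := h.cross_eq i j
  have hxj : cross x (z j) = -(ρ * ‖toC (z j)‖ * Real.sin (cumAngle z j - θ)) := by
    rw [Real.sin_sub, cross, h0, h1, (h.coord j).1, (h.coord j).2]
    ring
  have hix : cross (z i) x = -(‖toC (z i)‖ * ρ * Real.sin (θ - cumAngle z i)) := by
    rw [Real.sin_sub, cross, h0, h1, (h.coord i).1, (h.coord i).2]
    ring
  have hne : cross (z i) (z j) ≠ 0 := by
    rw [hcij]
    exact neg_ne_zero.2 (by positivity)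
  apply smul_right_injective Plane hne
  simp only
  rw [hc, smul_add, smul_smul, smul_smul, hxj, hix, hcij]
  congr 2 <;> field_simp

/-- Every vector lies in the cone of one of the steps of a walk that goes around the origin. -/
lemma exists_cone_of_loop (h : ClockwiseLoop r z) (x : Plane) :
    ∃ m < r, ∃ α β : ℝ, 0 ≤ α ∧ 0 ≤ β ∧ x = α • z m + β • z (m + 1) := by
  -- the direction of `x` is normalized so as to be in the first full turn of the walk
  set θ := toIcoMod Real.two_pi_pos (cumAngle z 0) (-Complex.arg (toC x)) with hθ
  have hmem := toIcoMod_mem_Ico Real.two_pi_pos (cumAngle z 0) (-Complex.arg (toC x))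
  rw [← hθ] at hmem
  have hθ' : θ = -Complex.arg (toC x) -
      toIcoDiv Real.two_pi_pos (cumAngle z 0) (-Complex.arg (toC x)) • (2 * Real.pi) := rfl
  rw [zsmul_eq_mul] at hθ'
  obtain ⟨a1, a2⟩ := coord_of_polar (toC_polar x)
  obtain ⟨m, hm, hm1, hm2⟩ := exists_step (cumAngle z) θ r hmem.1
    (by linarith [hmem.2, h.two_pi_le])
  refine ⟨m, hm, h.exists_cone (norm_nonneg (toC x)) ?_ ?_ hm1 hm2.le (h.lt_succ m) (h.succ_lt m)⟩
  · rw [hθ', Real.cos_sub_int_mul_two_pi]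
    exact a1
  · rw [hθ', Real.sin_sub_int_mul_two_pi]
    exact a2

/-- A vector on the near side of all lines of the steps of the walk lies in one of the triangles
spanned by the origin and a step. -/
lemma exists_triangle (h : ClockwiseLoop r z) {x : Plane}
    (hx : ∀ m < r, lineForm (z m) (z (m + 1)) x ≤ 1) :
    ∃ m < r, ∃ α β : ℝ, 0 ≤ α ∧ 0 ≤ β ∧ α + β ≤ 1 ∧ x = α • z m + β • z (m + 1) := by
  obtain ⟨m, hm, α, β, hα, hβ, he⟩ := h.exists_cone_of_loop x
  refine ⟨m, hm, α, β, hα, hβ, ?_, he⟩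
  have := hx m hm
  rw [he, map_add, map_smul, map_smul, lineForm_left (h.turn m).ne,
    lineForm_right (h.turn m).ne] at this
  simpa using this

end ClockwiseLoop

lemma mem_triangle {p a b x : Plane} {α β : ℝ} (hα : 0 ≤ α) (hβ : 0 ≤ β) (hab : α + β ≤ 1)
    (hx : x - p = α • (a - p) + β • (b - p)) {C : Set Plane} (hC : Convex ℝ C) (hp : p ∈ C)
    (ha : a ∈ C) (hb : b ∈ C) : x ∈ C := by
  have : x = (1 - α - β) • p + α • a + β • b := by
    have : x = p + (α • (a - p) + β • (b - p)) := by rw [← hx]; abel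
    rw [this]
    module
  rw [this]
  have := hC.sum_mem (t := Finset.univ) (w := ![1 - α - β, α, β]) (z := ![p, a, b])
    (by intro i _; fin_cases i <;> simp <;> linarith)
    (by simp only [Fin.sum_univ_three, Matrix.cons_val]; ring)
    (by intro i _; fin_cases i <;> simpa)
  simpa [Fin.sum_univ_three] using this

/-! ### Halfplanes and lines -/

/-- Three points of a boundary line are collinear. -/
lemma HalfPlane.cross_eq_zero {H : HalfPlane} {x y v : Plane} (hx : x ∈ H.line) (hy : y ∈ H.line)
    (hv : v ∈ H.line) : cross (x - v) (y - v) = 0 := by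
  simp only [HalfPlane.line, Set.mem_ofPred_eq] at hx hy hv
  have h1 : H.a * (x 0 - v 0) + H.b * (x 1 - v 1) = 0 := by linarith
  have h2 : H.a * (y 0 - v 0) + H.b * (y 1 - v 1) = 0 := by linarith
  simp only [cross, PiLp.sub_apply]
  have := H.unit
  linear_combination (-(x 0 - v 0) * (y 1 - v 1) + (x 1 - v 1) * (y 0 - v 0)) * this
    + (H.a * (y 1 - v 1) - H.b * (y 0 - v 0)) * h1 + (-H.a * (x 1 - v 1) + H.b * (x 0 - v 0)) * h2

lemma HalfPlane.line_subset_carrier (H : HalfPlane) : H.line ⊆ H.carrier :=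
  fun _ hx => (show _ = _ from hx).ge

lemma HalfPlane.convex_line (H : HalfPlane) : Convex ℝ H.line := by
  intro x hx y hy s t _ _ hst
  simp only [HalfPlane.line, Set.mem_ofPred_eq, PiLp.add_apply, PiLp.smul_apply, smul_eq_mul] at *
  linear_combination s * hx + t * hy - H.c * hst

/-- Two boundary lines through a common point, each with a further point, meet in that point only
if the two directions differ. -/
lemma HalfPlane.line_inter_line {H H' : HalfPlane} {u v w : Plane} (hu : u ∈ H.line)
    (hv : v ∈ H.line) (hv' : v ∈ H'.line) (hw : w ∈ H'.line) (hne : cross (u - v) (w - v) ≠ 0) :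
    H.line ∩ H'.line = {v} := by
  ext x
  simp only [Set.mem_inter_iff, Set.mem_singleton_iff]
  constructor
  · rintro ⟨hx, hx'⟩
    have h1 := HalfPlane.cross_eq_zero hu hx hv
    have h2 := HalfPlane.cross_eq_zero hx' hw hv'
    have := cross_smul_eq (u - v) (w - v) (x - v)
    rw [h1, h2, zero_smul, zero_smul, add_zero] at this
    exact sub_eq_zero.1 ((smul_eq_zero.1 this).resolve_left hne)
  · rintro rfl
    exact ⟨hv, hv'⟩

/-- The sides of a boundary line, seen from a point `p` of its complement: if `p` and `x` are
weakly on the same side of the directed line from `u` to `v`, while the halfplane contains `x` and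
not `p`, then `x` is on the line. -/
lemma HalfPlane.cross_eq_zero_of_mem {H : HalfPlane} {u v x p : Plane} (hu : u ∈ H.line)
    (hv : v ∈ H.line) (hp : p ∉ H.carrier) (hpc : cross (v - u) (p - u) < 0) (hx : x ∈ H.carrier)
    (hxc : cross (v - u) (x - u) ≤ 0) : cross (v - u) (x - u) = 0 := by
  simp only [HalfPlane.line, HalfPlane.carrier, Set.mem_ofPred_eq, not_le] at *
  have hd : H.a * (v 0 - u 0) + H.b * (v 1 - u 1) = 0 := by linarith
  -- both affine functions vanish on the line, hence they are proportional
  have key : (H.a * x 0 + H.b * x 1 + H.c) * cross (v - u) (p - u)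
      = cross (v - u) (x - u) * (H.a * p 0 + H.b * p 1 + H.c) := by
    simp only [cross, PiLp.sub_apply]
    linear_combination ((x 0 - u 0) * (p 1 - u 1) - (x 1 - u 1) * (p 0 - u 0)) * hd
      + (((v 0 - u 0) * (p 1 - u 1) - (v 1 - u 1) * (p 0 - u 0))
      - ((v 0 - u 0) * (x 1 - u 1) - (v 1 - u 1) * (x 0 - u 0))) * hu
  have h1 := mul_nonpos_of_nonneg_of_nonpos hx hpc.le
  by_contra hne
  have := mul_pos_of_neg_of_neg (lt_of_le_of_ne hxc hne) hp
  linarith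

lemma cross_sub_sub (p u v : Plane) : cross (v - u) (p - u) = cross (u - p) (v - p) := by
  simp only [cross, PiLp.sub_apply]
  ring

/-- An open halfplane together with a convex subset of its boundary is convex. -/
lemma convex_mem_or_cross_neg {E : Set Plane} (hE : Convex ℝ E) (d u : Plane)
    (h0 : ∀ x ∈ E, cross d (x - u) = 0) : Convex ℝ {x | x ∈ E ∨ cross d (x - u) < 0} := by
  intro x hx y hy s t hs ht hst
  simp only [Set.mem_ofPred_eq] at *
  have key : cross d (s • x + t • y - u) = s * cross d (x - u) + t * cross d (y - u) := by
    simp only [cross, PiLp.sub_apply, PiLp.add_apply, PiLp.smul_apply, smul_eq_mul]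
    linear_combination (d 0 * u 1 - d 1 * u 0) * hst
  rcases hs.eq_or_lt with rfl | hs'
  · obtain rfl : t = 1 := by linarith
    simpa using hy
  rcases ht.eq_or_lt with rfl | ht'
  · obtain rfl : s = 1 := by linarith
    simpa using hx
  rw [key]
  rcases hx with hx | hx <;> rcases hy with hy | hy
  · exact Or.inl (hE hx hy hs ht hst)
  · right
    rw [h0 x hx]
    nlinarith
  · right
    rw [h0 y hy]
    nlinarith
  · right
    nlinarith

lemma HalfPlane.mem_line_of_lineForm_eq_one {H : HalfPlane} {p u v x : Plane} (hu : u ∈ H.line)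
    (hv : v ∈ H.line) (hne : cross (u - p) (v - p) ≠ 0)
    (hx : lineForm (u - p) (v - p) (x - p) = 1) : x ∈ H.line := by
  have h1 := cross_smul_eq (u - p) (v - p) (x - p)
  rw [lineForm_apply, div_eq_one_iff_eq hne] at hx
  have h2 := congrFun (congrArg (fun w : Plane => (w : Fin 2 → ℝ)) h1) 0
  have h3 := congrFun (congrArg (fun w : Plane => (w : Fin 2 → ℝ)) h1) 1
  simp only [PiLp.sub_apply, PiLp.add_apply, PiLp.smul_apply, smul_eq_mul] at h2 h3
  simp only [HalfPlane.line, Set.mem_ofPred_eq] at *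
  apply mul_left_cancel₀ hne
  linear_combination H.a * h2 + H.b * h3 + cross (x - p) (v - p) * hu + cross (u - p) (x - p) * hv
    + (-(H.a * p 0 + H.b * p 1 + H.c)) * hx

/-! ### Convex polygons -/

namespace ConvexPolygon

variable (Γ : ConvexPolygon)

instance : NeZero Γ.n := ⟨by have := Γ.three_le; omega⟩

lemma natCast_ne {i j : ℕ} (hij : i < j) (hj : j < i + Γ.n) :
    (j : ZMod Γ.n) ≠ (i : ZMod Γ.n) := by
  intro h
  have h1 := (ZMod.natCast_eq_natCast_iff' _ _ _).1 h
  have h2 := (Nat.modEq_iff_dvd' hij.le).1 (show i ≡ j [MOD Γ.n] from h1.symm)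
  have := Nat.le_of_dvd (by omega) h2
  omega

lemma add_two_ne (i : ZMod Γ.n) : i + 1 + 1 ≠ i ∧ i + 1 + 1 ≠ i + 1 := by
  have h3 := Γ.three_le
  have h := ZMod.natCast_zmod_val i
  constructor
  · have := Γ.natCast_ne (i := i.val) (j := i.val + 1 + 1) (by omega) (by omega)
    push_cast [h] at this
    exact this
  · have := Γ.natCast_ne (i := i.val + 1) (j := i.val + 1 + 1) (by omega) (by omega)
    push_cast [h] at this
    exact this

lemma vertex_mem_region (i : ZMod Γ.n) : Γ.vertex i ∈ Γ.region :=
  subset_convexHull ℝ _ ⟨i, rfl⟩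

lemma convex_region : Convex ℝ Γ.region := convex_convexHull ℝ _

lemma edge_subset_region (i : ZMod Γ.n) : Γ.edge i ⊆ Γ.region :=
  Γ.convex_region.segment_subset (Γ.vertex_mem_region i) (Γ.vertex_mem_region (i + 1))

lemma cross_eq_zero_of_mem_edge (i : ZMod Γ.n) {x : Plane} (hx : x ∈ Γ.edge i) :
    cross (Γ.vertex (i + 1) - Γ.vertex i) (x - Γ.vertex i) = 0 := by
  obtain ⟨s, t, _, _, hst, rfl⟩ := hx
  simp only [cross, PiLp.sub_apply, PiLp.add_apply, PiLp.smul_apply, smul_eq_mul]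
  linear_combination ((Γ.vertex (i + 1) 0 - Γ.vertex i 0) * Γ.vertex i 1
    - (Γ.vertex (i + 1) 1 - Γ.vertex i 1) * Γ.vertex i 0) * hst

/-- A polygon lies to the right of each of its edges, and meets the line of the edge only in the
edge. -/
lemma mem_edge_or_cross_neg (i : ZMod Γ.n) {x : Plane} (hx : x ∈ Γ.region) :
    x ∈ Γ.edge i ∨ cross (Γ.vertex (i + 1) - Γ.vertex i) (x - Γ.vertex i) < 0 := by
  refine convexHull_min ?_ (convex_mem_or_cross_neg (convex_segment _ _) _ _
    fun x => Γ.cross_eq_zero_of_mem_edge i) hx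
  rintro _ ⟨j, rfl⟩
  by_cases h1 : j = i
  · subst h1
    exact Or.inl (left_mem_segment ℝ _ _)
  by_cases h2 : j = i + 1
  · subst h2
    exact Or.inl (right_mem_segment ℝ _ _)
  exact Or.inr (Γ.convex i j h1 h2)

/-! ### Polygons whose edges lie on lines of the arrangement -/

section Compatible

variable {Γ} {ℋ : Finset HalfPlane} {p : Plane}

lemma edge_subset_line_iff {i : ZMod Γ.n} {H : HalfPlane} :
    Γ.edge i ⊆ H.line ↔ Γ.vertex i ∈ H.line ∧ Γ.vertex (i + 1) ∈ H.line :=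
  ⟨fun h => ⟨h (left_mem_segment ℝ _ _), h (right_mem_segment ℝ _ _)⟩,
    fun h => H.convex_line.segment_subset h.1 h.2⟩

/-- A point of the polygon off the line of an edge is strictly to the right of the edge. -/
lemma cross_neg_of_notMem_carrier {i : ZMod Γ.n} {H : HalfPlane} (he : Γ.edge i ⊆ H.line)
    (hpH : p ∉ H.carrier) (hp : p ∈ Γ.region) :
    cross (Γ.vertex (i + 1) - Γ.vertex i) (p - Γ.vertex i) < 0 :=
  (Γ.mem_edge_or_cross_neg i hp).resolve_left fun h => hpH (H.line_subset_carrier (he h))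

/-- A halfplane that avoids a point of the polygon and has an edge on its boundary line meets the
polygon in this edge. -/
lemma isEdgeHalfplane {i : ZMod Γ.n} {H : HalfPlane} (hH : H ∈ ℋ) (he : Γ.edge i ⊆ H.line)
    (hpH : p ∉ H.carrier) (hp : p ∈ Γ.region) : Γ.IsEdgeHalfplane ℋ i H := by
  refine ⟨hH, he, Set.Subset.antisymm ?_ fun x hx =>
    ⟨Γ.edge_subset_region i hx, H.line_subset_carrier (he hx)⟩⟩
  rintro x ⟨hx, hxH⟩
  rcases Γ.mem_edge_or_cross_neg i hx with h | h
  · exact h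
  · obtain ⟨h1, h2⟩ := edge_subset_line_iff.1 he
    exact absurd (HalfPlane.cross_eq_zero_of_mem h1 h2 hpH (cross_neg_of_notMem_carrier he hpH hp)
      hxH h.le) h.ne

/-- The point `p` is strictly to the right of every edge of `Γ`. -/
def StrictlyInside (Γ : ConvexPolygon) (p : Plane) : Prop :=
  ∀ i : ZMod Γ.n, cross (Γ.vertex (i + 1) - Γ.vertex i) (p - Γ.vertex i) < 0

lemma Compatible.strictlyInside (hΓ : Γ.Compatible ℋ) (hp : ∀ H ∈ ℋ, p ∉ H.carrier)
    (hpΓ : p ∈ Γ.region) : Γ.StrictlyInside p := fun i => by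
  obtain ⟨H, hH, he, -⟩ := hΓ i
  exact cross_neg_of_notMem_carrier he (hp H hH) hpΓ

end Compatible

/-! ### Walking around a convex polygon -/

section Corner

variable {Γ} {p : Plane}

/-- The vertices of a polygon, listed cyclically and relative to the point `p`. -/
def corner (Γ : ConvexPolygon) (p : Plane) (m : ℕ) : Plane := Γ.vertex (m : ZMod Γ.n) - p

lemma corner_succ (m : ℕ) : Γ.corner p (m + 1) = Γ.vertex ((m : ZMod Γ.n) + 1) - p := by
  simp [corner]

lemma StrictlyInside.clockwiseLoop (h : Γ.StrictlyInside p) :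
    ClockwiseLoop Γ.n (Γ.corner p) where
  pos := by have := Γ.three_le; omega
  periodic m := by simp [corner]
  turn m := by
    rw [corner_succ, corner, ← cross_sub_sub]
    exact h m

lemma StrictlyInside.cross_eq (h : Γ.StrictlyInside p) (m : ℕ) (x : Plane) :
    cross (Γ.vertex ((m : ZMod Γ.n) + 1) - Γ.vertex m) (x - Γ.vertex m) =
      cross (Γ.corner p m) (Γ.corner p (m + 1)) *
        (1 - lineForm (Γ.corner p m) (Γ.corner p (m + 1)) (x - p)) := by
  rw [← cross_sub_eq_lineForm (h.clockwiseLoop.turn m).ne, corner_succ, corner]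
  simp only [sub_sub_sub_cancel_right]

lemma StrictlyInside.lineForm_corner_le (h : Γ.StrictlyInside p) (m : ℕ) {x : Plane}
    (hx : x ∈ Γ.region) : lineForm (Γ.corner p m) (Γ.corner p (m + 1)) (x - p) ≤ 1 := by
  have he := h.cross_eq m x
  have ht := h.clockwiseLoop.turn m
  rcases Γ.mem_edge_or_cross_neg (m : ZMod Γ.n) hx with hE | hE
  · rw [Γ.cross_eq_zero_of_mem_edge _ hE] at he
    have := (mul_eq_zero.1 he.symm).resolve_left ht.ne
    linarith
  · rw [he] at hE
    by_contra! hgt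
    have := mul_pos_of_neg_of_neg ht (sub_neg.2 hgt)
    linarith

lemma StrictlyInside.lineForm_corner_lt (h : Γ.StrictlyInside p) {m j : ℕ}
    (h1 : (j : ZMod Γ.n) ≠ m) (h2 : (j : ZMod Γ.n) ≠ m + 1) :
    lineForm (Γ.corner p m) (Γ.corner p (m + 1)) (Γ.corner p j) < 1 := by
  have he := Γ.convex m j h1 h2
  rw [h.cross_eq m] at he
  by_contra! hge
  have := mul_nonneg_of_nonpos_of_nonpos (h.clockwiseLoop.turn m).le (sub_nonpos.2 hge)
  exact absurd he (not_lt.2 this)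

/-- The boundary of a convex polygon goes around an inner point only once: in a second turn, some edge
would cross the ray through the first vertex. That vertex is strictly on the near side of the edge, so
the edge would cross the ray beyond it, outside of the polygon. -/
lemma StrictlyInside.cumAngle_corner (h : Γ.StrictlyInside p) :
    cumAngle (Γ.corner p) Γ.n - cumAngle (Γ.corner p) 0 = 2 * Real.pi := by
  have hl := h.clockwiseLoop
  have hπ := Real.pi_pos
  obtain ⟨c, hc1, hc⟩ := hl.exists_winding
  rcases hc1.eq_or_lt with rfl | hc2
  · simpa using hc
  exfalso
  have hc2' : (2 : ℝ) ≤ c := by exact_mod_cast hc2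
  have hbig : 4 * Real.pi ≤ cumAngle (Γ.corner p) Γ.n - cumAngle (Γ.corner p) 0 := by
    rw [hc]
    nlinarith
  obtain ⟨i, hi, hi1, hi2⟩ := exists_step (cumAngle (Γ.corner p))
    (cumAngle (Γ.corner p) 0 + 2 * Real.pi) Γ.n (by linarith) (by linarith)
  have hi0 : 0 < i := by
    rw [Nat.pos_iff_ne_zero]
    rintro rfl
    linarith [hl.succ_lt 0]
  have hin : i + 1 < Γ.n := by
    refine lt_of_le_of_ne hi fun hn => ?_
    rw [← hn] at hbig
    linarith [hl.succ_lt i]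
  obtain ⟨α, β, hα, hβ, he⟩ := hl.exists_cone (x := Γ.corner p 0)
    (ρ := ‖toC (Γ.corner p 0)‖) (θ := cumAngle (Γ.corner p) 0 + 2 * Real.pi) (norm_nonneg _)
    (by rw [Real.cos_add_two_pi]; exact (hl.coord 0).1)
    (by rw [Real.sin_add_two_pi]; exact (hl.coord 0).2) hi1 hi2.le (hl.lt_succ i) (hl.succ_lt i)
  have hlt : lineForm (Γ.corner p i) (Γ.corner p (i + 1)) (Γ.corner p 0) < 1 := by
    apply h.lineForm_corner_lt
    · exact (Γ.natCast_ne hi0 (by omega)).symm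
    · have := (Γ.natCast_ne (i := 0) (j := i + 1) (by omega) (by omega)).symm
      push_cast at this ⊢
      exact this
  rw [he, map_add, map_smul, map_smul, lineForm_left (hl.turn i).ne,
    lineForm_right (hl.turn i).ne] at hlt
  have h0 := lineForm_left (hl.turn 0).ne
  have he' := congrArg (lineForm (Γ.corner p 0) (Γ.corner p (0 + 1))) he
  rw [h0, map_add, map_smul, map_smul] at he'
  have h1 := h.lineForm_corner_le 0 (Γ.vertex_mem_region (i : ZMod Γ.n))
  have h2 := h.lineForm_corner_le 0 (Γ.vertex_mem_region ((i : ZMod Γ.n) + 1))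
  rw [← corner_succ] at h2
  rw [← corner] at h1
  simp only [smul_eq_mul, mul_one] at he' hlt
  nlinarith [mul_le_mul_of_nonneg_left h1 hα, mul_le_mul_of_nonneg_left h2 hβ]

lemma StrictlyInside.mem_interior (h : Γ.StrictlyInside p) (hp : p ∈ Γ.region) :
    p ∈ interior Γ.region := by
  refine _root_.mem_interior.2 ⟨⋂ m ∈ Finset.range Γ.n,
    {x | lineForm (Γ.corner p m) (Γ.corner p (m + 1)) (x - p) < 1}, ?_, ?_, ?_⟩
  · intro x hx
    simp only [Set.mem_iInter, Finset.mem_range, Set.mem_ofPred_eq] at hx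
    obtain ⟨m, -, α, β, hα, hβ, hab, he⟩ := h.clockwiseLoop.exists_triangle fun m hm => (hx m hm).le
    rw [corner_succ, corner] at he
    exact mem_triangle hα hβ hab he Γ.convex_region hp (Γ.vertex_mem_region _)
      (Γ.vertex_mem_region _)
  · refine isOpen_biInter_finset fun m _ => isOpen_lt ?_ continuous_const
    exact (LinearMap.continuous_of_finiteDimensional _).comp (continuous_id.sub continuous_const)
  · simp

end Corner

end ConvexPolygon

/-! ### Directed cycles as closed walks -/

lemma Seg.ne_of_cross {p : Plane} {φ : Seg} (h : cross (φ.left - p) (φ.right - p) < 0) :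
    φ.dir ≠ 0 := by
  intro h0
  rw [Seg.dir, sub_eq_zero] at h0
  rw [h0, cross_self] at h
  exact lt_irrefl _ h

section Cycle

variable {S S' : Finset Plane} {ℋ : Finset HalfPlane} {p : Plane} {k : ℕ}

/-- The first segment of the `m`-th vertex of a directed cycle of length `r`, where `m` runs through
all natural numbers. -/
def cycleSeg (r : ℕ) (v : ℕ → Vert S S' ℋ p k) (m : ℕ) : Seg := (v (m % r)).1 0

variable {r : ℕ} {v : ℕ → Vert S S' ℋ p k}

lemma IsDirectedCycle.apply_succ_mod (hv : IsDirectedCycle (chainGraph S S' ℋ p k) r v) (m : ℕ) :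
    v ((m + 1) % r) = v (m % r + 1) := by
  have hm := Nat.mod_lt m hv.pos
  rw [← Nat.mod_add_mod]
  rcases (show m % r + 1 ≤ r from hm).lt_or_eq with h | h
  · rw [Nat.mod_eq_of_lt h]
  · rw [h, Nat.mod_self, hv.closed]

lemma IsDirectedCycle.adj_mod (hv : IsDirectedCycle (chainGraph S S' ℋ p k) r v) (m : ℕ) :
    (chainGraph S S' ℋ p k).Adj (v (m % r)) (v ((m + 1) % r)) := by
  rw [hv.apply_succ_mod]
  exact hv.adj _ (Nat.mod_lt m hv.pos)

/-- The tuples in a directed cycle are the runs of consecutive segments of one cyclic sequence. -/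
lemma IsDirectedCycle.apply_eq (hv : IsDirectedCycle (chainGraph S S' ℋ p k) r v) (j : ℕ)
    (hj : j < k + 1) (m : ℕ) : (v (m % r)).1 ⟨j, hj⟩ = cycleSeg r v (m + j) := by
  induction j generalizing m with
  | zero => rfl
  | succ j ih =>
    have h := hv.adj_mod m ⟨j, by omega⟩
    have h' := ih (by omega) (m + 1)
    rw [show m + (j + 1) = m + 1 + j by ring, ← h']
    exact h

lemma IsDirectedCycle.cycleSeg_mem (m : ℕ) :
    cycleSeg r v m ∈ segments ℋ p := (v (m % r)).2.mem 0

lemma IsDirectedCycle.right_eq (hv : IsDirectedCycle (chainGraph S S' ℋ p k) r v) (hk : 1 ≤ k)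
    (m : ℕ) : (cycleSeg r v m).right = (cycleSeg r v (m + 1)).left := by
  have h := (v (m % r)).2.chain ⟨0, by omega⟩
  have h1 := hv.apply_eq 1 (by omega) m
  rw [← h1]
  exact h.symm

lemma IsDirectedCycle.cross_dir_nonpos (hv : IsDirectedCycle (chainGraph S S' ℋ p k) r v)
    (hk : 1 ≤ k) (m : ℕ) : cross (cycleSeg r v m).dir (cycleSeg r v (m + 1)).dir ≤ 0 := by
  apply cross_nonpos_of_ang_le (Seg.ne_of_cross (cycleSeg_mem m).2)
    (Seg.ne_of_cross (cycleSeg_mem (m + 1)).2)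
  have h := (v (m % r)).2.convex ⟨0, by omega⟩
  rw [← hv.apply_eq 1 (by omega) m]
  exact h

/-- The left endpoints of the segments of a directed cycle, relative to `p`. -/
def cyclePoint (r : ℕ) (v : ℕ → Vert S S' ℋ p k) (m : ℕ) : Plane := (cycleSeg r v m).left - p

lemma IsDirectedCycle.clockwiseLoop (hv : IsDirectedCycle (chainGraph S S' ℋ p k) r v)
    (hk : 1 ≤ k) : ClockwiseLoop r (cyclePoint r v) where
  pos := hv.pos
  periodic m := by simp [cyclePoint, cycleSeg]
  turn m := by
    rw [cyclePoint, cyclePoint, ← hv.right_eq hk]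
    exact (cycleSeg_mem m).2

lemma IsDirectedCycle.sum_weight (hv : IsDirectedCycle (chainGraph S S' ℋ p k) r v) :
    ∑ i ∈ Finset.range r, weight (v i) (v (i + 1)) =
      cumAngle (cyclePoint r v) r - cumAngle (cyclePoint r v) 0 := by
  rw [← sum_ang_eq]
  refine Finset.sum_congr rfl fun i hi => ?_
  have h := hv.apply_succ_mod i
  rw [Nat.mod_eq_of_lt (Finset.mem_range.1 hi)] at h
  rw [← h, weight, cyclePoint, cyclePoint, cycleSeg, cycleSeg,
    Nat.mod_eq_of_lt (Finset.mem_range.1 hi)]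

lemma two_pi_le_of_mem_cycleLengths (hk : 1 ≤ k) {L : ℝ}
    (hL : L ∈ cycleLengths (chainGraph S S' ℋ p k) weight) : 2 * Real.pi ≤ L := by
  obtain ⟨r, v, hv, rfl⟩ := hL
  rw [hv.sum_weight]
  exact (hv.clockwiseLoop hk).two_pi_le

end Cycle

/-! ### The cycle of a well-behaved polygon -/

namespace ConvexPolygon

variable {Γ : ConvexPolygon} {S S' : Finset Plane} {ℋ : Finset HalfPlane} {p : Plane} {k : ℕ}

/-- The `m`-th edge of a polygon as a segment directed clockwise. -/
def edgeSeg (Γ : ConvexPolygon) (m : ℕ) : Seg :=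
  ⟨Γ.vertex (m : ZMod Γ.n), Γ.vertex ((m + 1 : ℕ) : ZMod Γ.n)⟩

lemma carrier_edgeSeg (m : ℕ) : (Γ.edgeSeg m).carrier = Γ.edge m := by
  simp [Seg.carrier, edgeSeg, edge]

lemma dir_edgeSeg (m : ℕ) :
    (Γ.edgeSeg m).dir = Γ.vertex ((m : ZMod Γ.n) + 1) - Γ.vertex m := by
  simp [Seg.dir, edgeSeg]

lemma cross_edge_edge (i : ZMod Γ.n) : cross (Γ.vertex (i + 1) - Γ.vertex i)
    (Γ.vertex (i + 1 + 1) - Γ.vertex (i + 1)) < 0 := by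
  have h := Γ.convex i (i + 1 + 1) (Γ.add_two_ne i).1 (Γ.add_two_ne i).2
  simp only [cross, PiLp.sub_apply] at h ⊢
  linarith

lemma vertex_injective (Γ : ConvexPolygon) : Function.Injective Γ.vertex := by
  intro i j hij
  by_contra hne
  by_cases h1 : j = i + 1
  · have := Γ.convex i (i + 1 + 1) (Γ.add_two_ne i).1 (Γ.add_two_ne i).2
    rw [← h1, hij] at this
    simp [cross] at this
  · have := Γ.convex i j (Ne.symm hne) h1
    rw [hij] at this
    simp [cross] at this

/-- The lines of neighbouring edges meet in the common vertex only. -/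
lemma line_inter_line {i : ZMod Γ.n} {H H' : HalfPlane} (he : Γ.edge i ⊆ H.line)
    (he' : Γ.edge (i + 1) ⊆ H'.line) : H.line ∩ H'.line = {Γ.vertex (i + 1)} := by
  rw [edge_subset_line_iff] at he he'
  refine HalfPlane.line_inter_line he.1 he.2 he'.1 he'.2 ?_
  have := Γ.cross_edge_edge i
  simp only [cross, PiLp.sub_apply] at this ⊢
  intro h0
  linarith

lemma Compatible.edgeSeg_mem_segments (hΓ : Γ.Compatible ℋ) (h : Γ.StrictlyInside p) (m : ℕ) :
    Γ.edgeSeg m ∈ segments ℋ p := by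
  obtain ⟨H₁, hH₁, he₁, -⟩ := hΓ ((m : ZMod Γ.n) - 1)
  obtain ⟨H₂, hH₂, he₂, -⟩ := hΓ (m : ZMod Γ.n)
  obtain ⟨H₃, hH₃, he₃, -⟩ := hΓ ((m : ZMod Γ.n) + 1)
  have h₁₂ := line_inter_line he₁ (show Γ.edge (m - 1 + 1) ⊆ H₂.line by rwa [sub_add_cancel])
  have h₂₃ := line_inter_line he₂ he₃
  refine ⟨⟨H₂.line, ⟨H₂, hH₂, rfl⟩, ⟨H₁.line, ⟨H₁, hH₁, rfl⟩, ?_⟩, ⟨H₃.line, ⟨H₃, hH₃, rfl⟩, ?_⟩⟩,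
    h.clockwiseLoop.turn m⟩
  · rw [Set.inter_comm, h₁₂, sub_add_cancel]
    rfl
  · rw [h₂₃, edgeSeg, Nat.cast_add, Nat.cast_one]

/-- The triangle spanned by an inner point and an edge reaches the boundary of the polygon only
in the edge. -/
lemma StrictlyInside.mem_edge_of_mem_triangle (h : Γ.StrictlyInside p) (hp : p ∈ Γ.region) {m : ℕ}
    {x : Plane} (hx : x ∈ (Γ.edgeSeg m).triangle p) (hxi : x ∉ interior Γ.region) :
    x ∈ (Γ.edgeSeg m).carrier := by
  rw [Seg.triangle, convexHull_insert (by simp), convexHull_pair] at hx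
  obtain ⟨_, rfl, y, hy, s, t, hs, ht, hst, rfl⟩ := mem_convexJoin.1 hx
  have hyE : y ∈ Γ.edge m := by
    rw [← carrier_edgeSeg]
    exact hy
  rcases hs.eq_or_lt with rfl | hs'
  · obtain rfl : t = 1 := by linarith
    simpa [Seg.carrier] using hy
  · exact absurd (Γ.convex_region.combo_interior_self_mem_interior (h.mem_interior hp)
      (Γ.edge_subset_region _ hyE) hs' ht hst) hxi

/-- Any `k + 1` consecutive edges of a well-behaved polygon form a vertex of the graph. -/
lemma WellBehaved.isChain (hw : Γ.WellBehaved S S' ℋ k) (hΓ : Γ.Compatible ℋ)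
    (hp : ∀ H ∈ ℋ, p ∉ H.carrier) (hpΓ : p ∈ Γ.region) (m : ℕ) :
    IsChain S S' ℋ p k fun j => Γ.edgeSeg (m + j) := by
  have h := hΓ.strictlyInside hp hpΓ
  refine ⟨fun _ => hΓ.edgeSeg_mem_segments h _, fun _ => rfl, fun i => ?_, ?_, ?_⟩
  · refine (ang_mem_of_cross_neg ?_).2.le
    have := Γ.cross_edge_edge ((m + i : ℕ) : ZMod Γ.n)
    simpa [dir_edgeSeg, add_assoc] using this
  · rintro s ⟨hs, hsU⟩
    obtain ⟨j, hj⟩ := Set.mem_iUnion.1 hsU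
    exact Set.mem_iUnion.2 ⟨j, h.mem_edge_of_mem_triangle hpΓ hj (hw.1 s hs)⟩
  · intro H hH
    refine hw.2 (m : ZMod Γ.n) H fun j => ?_
    obtain ⟨h1, h2⟩ := hH j
    rw [carrier_edgeSeg, Nat.cast_add] at h2
    exact isEdgeHalfplane h1 h2 (hp _ h1) hpΓ

/-- A well-behaved polygon gives a directed cycle, whose length is the full angle. -/
lemma WellBehaved.two_pi_mem_cycleLengths (hw : Γ.WellBehaved S S' ℋ k) (hΓ : Γ.Compatible ℋ)
    (hp : ∀ H ∈ ℋ, p ∉ H.carrier) (hpΓ : p ∈ Γ.region) :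
    2 * Real.pi ∈ cycleLengths (chainGraph S S' ℋ p k) weight := by
  have h := hΓ.strictlyInside hp hpΓ
  have h3 := Γ.three_le
  refine ⟨Γ.n, fun m => ⟨fun j => Γ.edgeSeg (m + j), hw.isChain hΓ hp hpΓ m⟩,
    ⟨by omega, ?_, ?_, ?_⟩, ?_⟩
  · apply Subtype.ext
    funext j
    simp [edgeSeg]
  · intro i _ j
    simp only [Fin.val_succ, Fin.val_castSucc]
    congr 1
    ring
  · intro i hi j hj hij
    have hij' := congrFun (congrArg Subtype.val hij) 0
    have hv : Γ.vertex (i : ZMod Γ.n) = Γ.vertex (j : ZMod Γ.n) := by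
      exact congrArg Seg.left hij'
    have hc := Γ.vertex_injective hv
    rcases lt_trichotomy i j with hlt | heq | hlt
    · exact absurd hc.symm (Γ.natCast_ne hlt (by have := Set.mem_Iio.1 hj; omega))
    · exact heq
    · exact absurd hc (Γ.natCast_ne hlt (by have := Set.mem_Iio.1 hi; omega))
  · rw [← h.cumAngle_corner, ← sum_ang_eq]
    rfl

end ConvexPolygon

/-! ### Locally convex walks with a single turn -/

/-- The linear form of the line of the `m`-th step of a walk. -/
noncomputable abbrev stepForm (z : ℕ → Plane) (m : ℕ) : Plane →ₗ[ℝ] ℝ := lineForm (z m) (z (m + 1))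

/-- The walk bends strictly to the right after its `m`-th step. -/
def Bends (z : ℕ → Plane) (m : ℕ) : Prop := cross (z (m + 1) - z m) (z (m + 2) - z (m + 1)) < 0

/-- The index of the step before the `a`-th bend. -/
noncomputable def bendIndex (z : ℕ → Plane) (a : ℕ) : ℕ := Nat.nth (Bends z) a

/-- A closed walk that goes exactly once clockwise around the origin and never bends to the left. -/
structure ConvexLoop (r : ℕ) (z : ℕ → Plane) : Prop extends ClockwiseLoop r z where
  full : cumAngle z r - cumAngle z 0 = 2 * Real.pi
  bend : ∀ m, cross (z (m + 1) - z m) (z (m + 2) - z (m + 1)) ≤ 0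

namespace ClockwiseLoop

variable {r : ℕ} {z : ℕ → Plane}

lemma stepForm_left (h : ClockwiseLoop r z) (m : ℕ) : stepForm z m (z m) = 1 :=
  lineForm_left (h.turn m).ne

lemma stepForm_right (h : ClockwiseLoop r z) (m : ℕ) : stepForm z m (z (m + 1)) = 1 :=
  lineForm_right (h.turn m).ne

lemma cross_neg (h : ClockwiseLoop r z) {i j : ℕ} (hij : cumAngle z i < cumAngle z j)
    (hπ : cumAngle z j < cumAngle z i + Real.pi) : cross (z i) (z j) < 0 := by
  rw [h.cross_eq, neg_lt_zero]
  have := Real.sin_pos_of_pos_of_lt_pi (sub_pos.2 hij) (by linarith)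
  have := h.norm_pos i
  have := h.norm_pos j
  positivity

lemma cross_nonpos (h : ClockwiseLoop r z) {i j : ℕ} (hij : cumAngle z i ≤ cumAngle z j)
    (hπ : cumAngle z j ≤ cumAngle z i + Real.pi) : cross (z i) (z j) ≤ 0 := by
  rw [h.cross_eq, neg_nonpos]
  have := Real.sin_nonneg_of_nonneg_of_le_pi (sub_nonneg.2 hij) (by linarith)
  positivity

/-- As long as a walk stays on one line, it turns by less than a half turn. -/
lemma lt_add_pi (h : ClockwiseLoop r z) {f : Plane →ₗ[ℝ] ℝ} {a b : ℕ} (hab : a ≤ b)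
    (hf : ∀ m, a ≤ m → m ≤ b → f (z m) = 1) : cumAngle z b < cumAngle z a + Real.pi := by
  induction b, hab using Nat.le_induction with
  | base => linarith [Real.pi_pos]
  | succ b hab ih =>
    have ih' := ih fun m h1 h2 => hf m h1 (by omega)
    by_contra! hge
    -- otherwise the last step crosses the ray opposite to `z a`, on which `f` is negative
    obtain ⟨α, β, hα, hβ, he⟩ := h.exists_cone (x := -z a) (ρ := ‖toC (z a)‖)
      (θ := cumAngle z a + Real.pi) (norm_nonneg _)
      (by rw [Real.cos_add_pi, PiLp.neg_apply, (h.coord a).1]; ring)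
      (by rw [Real.sin_add_pi, PiLp.neg_apply, (h.coord a).2]; ring) ih'.le hge (h.lt_succ b)
      (h.succ_lt b)
    have := congrArg f he
    rw [map_neg, map_add, map_smul, map_smul, hf a le_rfl (by omega), hf b hab (by omega),
      hf (b + 1) (by omega) le_rfl] at this
    simp only [smul_eq_mul, mul_one] at this
    linarith

lemma stepForm_periodic (h : ClockwiseLoop r z) (m : ℕ) : stepForm z (m + r) = stepForm z m := by
  rw [stepForm, stepForm, h.periodic, show m + r + 1 = (m + 1) + r by ring, h.periodic]

lemma stepForm_succ_sub (h : ClockwiseLoop r z) (m : ℕ) (x : Plane) :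
    stepForm z (m + 1) x - stepForm z m x = cross (z (m + 1) - z m) (z (m + 2) - z (m + 1)) /
      (cross (z m) (z (m + 1)) * cross (z (m + 1)) (z (m + 2))) * cross (z (m + 1)) x :=
  lineForm_sub_lineForm (h.turn m).ne (h.turn (m + 1)).ne x

lemma bends_add (h : ClockwiseLoop r z) (m : ℕ) : Bends z (r + m) ↔ Bends z m := by
  rw [Bends, Bends, show r + m + 1 = (m + 1) + r by ring, show r + m + 2 = (m + 2) + r by ring,
    add_comm r m, h.periodic, h.periodic, h.periodic]

end ClockwiseLoop

lemma exists_mod_window {r : ℕ} (hr : 0 < r) (i j : ℕ) :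
    ∃ j', i ≤ j' ∧ j' < i + r ∧ j' % r = j % r := by
  refine ⟨i + (j + (r - 1) * i) % r, by omega, ?_, ?_⟩
  · have := Nat.mod_lt (j + (r - 1) * i) hr
    omega
  · rw [Nat.add_mod_mod]
    have : i + (j + (r - 1) * i) = j + r * i := by
      obtain ⟨s, rfl⟩ : ∃ s, r = s + 1 := ⟨r - 1, by omega⟩
      simp only [Nat.add_sub_cancel]
      ring
    rw [this, Nat.add_mul_mod_self_left]

namespace ConvexLoop

variable {r : ℕ} {z : ℕ → Plane}

lemma slope_nonpos (h : ConvexLoop r z) (m : ℕ) :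
    cross (z (m + 1) - z m) (z (m + 2) - z (m + 1)) /
      (cross (z m) (z (m + 1)) * cross (z (m + 1)) (z (m + 2))) ≤ 0 :=
  div_nonpos_of_nonpos_of_nonneg (h.bend m)
    (mul_pos_of_neg_of_neg (h.turn m) (h.turn (m + 1))).le

lemma slope_neg (h : ConvexLoop r z) {m : ℕ} (hm : Bends z m) :
    cross (z (m + 1) - z m) (z (m + 2) - z (m + 1)) /
      (cross (z m) (z (m + 1)) * cross (z (m + 1)) (z (m + 2))) < 0 :=
  div_neg_of_neg_of_pos hm (mul_pos_of_neg_of_neg (h.turn m) (h.turn (m + 1)))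

lemma stepForm_succ (h : ConvexLoop r z) {m : ℕ} (hm : ¬ Bends z m) :
    stepForm z (m + 1) = stepForm z m := by
  ext1 x
  have h0 := le_antisymm (h.bend m) (not_lt.1 hm)
  have := h.stepForm_succ_sub m x
  rw [h0, zero_div, zero_mul] at this
  linarith

lemma cumAngle_add_period (h : ConvexLoop r z) (m : ℕ) :
    cumAngle z (m + r) = cumAngle z m + 2 * Real.pi := by
  rw [h.cumAngle_add, h.full]

/-- Up to half a turn ahead, a point of the walk is on the near side of the line of a step, since
each bend moves the line outwards there. -/
lemma stepForm_le_one_ahead (h : ConvexLoop r z) {i j : ℕ} (hij : i ≤ j)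
    (hπ : cumAngle z j ≤ cumAngle z (i + 1) + Real.pi) : stepForm z i (z j) ≤ 1 := by
  induction hij using Nat.decreasingInduction with
  | self => exact (h.stepForm_left j).le
  | of_succ i hi ih =>
    have h1 := ih (hπ.trans (by linarith [h.lt_succ (i + 1)]))
    have h2 := h.cross_nonpos (h.strictMono.monotone (show i + 1 ≤ j from hi)) hπ
    have h3 := h.stepForm_succ_sub i (z j)
    have h4 := mul_nonneg_of_nonpos_of_nonpos (h.slope_nonpos i) h2
    linarith

lemma stepForm_le_one_behind (h : ConvexLoop r z) {i j : ℕ} (hij : j ≤ i)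
    (hπ : cumAngle z i ≤ cumAngle z j + Real.pi) : stepForm z i (z j) ≤ 1 := by
  induction i, hij using Nat.le_induction with
  | base => exact (h.stepForm_left j).le
  | succ i hi ih =>
    have h1 := ih (by linarith [h.lt_succ i])
    have h2 := h.cross_nonpos (h.strictMono.monotone (show j ≤ i + 1 by omega)) hπ
    have h3 := h.stepForm_succ_sub i (z j)
    have h5 : 0 ≤ cross (z (i + 1)) (z j) := by
      simp only [cross] at h2 ⊢
      linarith
    have h4 := mul_nonpos_of_nonpos_of_nonneg (h.slope_nonpos i) h5
    linarith

/-- Local convexity implies global convexity: the walk stays on the near side of each line. -/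
lemma stepForm_le_one (h : ConvexLoop r z) (i j : ℕ) : stepForm z i (z j) ≤ 1 := by
  obtain ⟨j', h1, h2, h3⟩ := exists_mod_window h.pos i j
  have hz : z j' = z j := by
    have hp : Function.Periodic z r := h.periodic
    rw [← hp.map_mod_nat j', h3, hp.map_mod_nat]
  rw [← hz]
  rcases le_total (cumAngle z j') (cumAngle z (i + 1) + Real.pi) with hle | hle
  · exact h.stepForm_le_one_ahead h1 hle
  · rw [← h.stepForm_periodic]
    refine h.stepForm_le_one_behind h2.le ?_
    rw [h.cumAngle_add_period]
    linarith [h.lt_succ i]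

/-- If a walk bends before the step `s + 1` and after the step `m`, and stays on one line in
between, then all its other points are strictly on the near side of this line. -/
lemma stepForm_lt_one (h : ConvexLoop r z) {s m j : ℕ} (hs : Bends z s) (hm : Bends z m)
    (hsm : s < m) (hform : stepForm z (s + 1) = stepForm z m) (hmj : m + 1 < j)
    (hjs : j < s + 1 + r) : stepForm z m (z j) < 1 := by
  have hlt : cumAngle z (s + 1) < cumAngle z (m + 1) := h.strictMono (by omega)
  have hper := h.cumAngle_add_period (s + 1)
  have hmj' := h.strictMono hmj
  have hjs' := h.strictMono hjs
  rcases lt_or_ge (cumAngle z j) (cumAngle z (m + 1) + Real.pi) with hπ | hπ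
  · have h1 := h.stepForm_le_one_ahead (show m + 1 ≤ j by omega)
      (by linarith [h.lt_succ (m + 1)])
    have h2 := mul_pos_of_neg_of_neg (h.slope_neg hm) (h.cross_neg hmj' hπ)
    have h3 := h.stepForm_succ_sub m (z j)
    linarith
  · have hsr : s + 1 + r = r + s + 1 := by ring
    rw [← hform, ← h.stepForm_periodic, hsr]
    rw [hsr] at hper hjs'
    have h1 := h.stepForm_le_one_behind (i := r + s) (j := j) (by omega)
      (by linarith [h.lt_succ (r + s)])
    have h2 := h.cross_neg hjs' (by linarith)
    have h5 : 0 < cross (z (r + s + 1)) (z j) := by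
      simp only [cross] at h2 ⊢
      linarith
    have h4 := mul_neg_of_neg_of_pos (h.slope_neg ((h.bends_add s).2 hs)) h5
    have h3 := h.stepForm_succ_sub (r + s) (z j)
    linarith

/-! ### Merging collinear steps -/

lemma stepForm_eq_of_not_bends (h : ConvexLoop r z) {a b : ℕ} (hab : a ≤ b)
    (hb : ∀ m, a ≤ m → m < b → ¬ Bends z m) : stepForm z b = stepForm z a := by
  induction b, hab using Nat.le_induction with
  | base => rfl
  | succ b hab ih =>
    rw [h.stepForm_succ (hb b hab (by omega)), ih fun m h1 h2 => hb m h1 (by omega)]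

/-- The walk has to bend again and again, as it would not get around the origin on one line. -/
lemma infinite_bends (h : ConvexLoop r z) : {m | Bends z m}.Infinite := by
  refine Set.infinite_of_forall_exists_gt fun M => ?_
  by_contra! hM
  have hb : ∀ m, M + 1 ≤ m → ¬ Bends z m := fun m hm hB => absurd (hM m hB) (by omega)
  have := h.lt_add_pi (f := stepForm z (M + 1)) (a := M + 1) (b := M + 1 + r) (by omega)
    fun m hm _ => by
      rw [← h.stepForm_eq_of_not_bends hm fun m' h1 _ => hb m' h1]
      exact h.stepForm_left m
  rw [h.cumAngle_add_period] at this
  linarith [Real.pi_pos]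

lemma bends_bendIndex (h : ConvexLoop r z) (a : ℕ) : Bends z (bendIndex z a) :=
  Nat.nth_mem_of_infinite h.infinite_bends a

lemma strictMono_bendIndex (h : ConvexLoop r z) : StrictMono (bendIndex z) :=
  Nat.nth_strictMono h.infinite_bends

/-- Between two successive bends the walk stays on one line. -/
lemma stepForm_eq (h : ConvexLoop r z) {a m : ℕ} (h1 : bendIndex z a < m)
    (h2 : m ≤ bendIndex z (a + 1)) : stepForm z m = stepForm z (bendIndex z (a + 1)) := by
  refine (h.stepForm_eq_of_not_bends h2 fun m' h3 h4 hB => ?_).symm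
  have : m' ≤ bendIndex z a := Nat.le_nth_of_lt_nth_succ h4 hB
  omega

lemma stepForm_apply_eq_one (h : ConvexLoop r z) {a m : ℕ} (h1 : bendIndex z a < m)
    (h2 : m ≤ bendIndex z (a + 1) + 1) : stepForm z (bendIndex z (a + 1)) (z m) = 1 := by
  rcases h2.lt_or_eq with h2 | rfl
  · rw [← h.stepForm_eq h1 (by omega)]
    exact h.stepForm_left m
  · exact h.stepForm_right _

/-- The bends repeat periodically, too. -/
lemma exists_bendIndex_add (h : ConvexLoop r z) :
    ∃ n, ∀ a, bendIndex z (a + n) = bendIndex z a + r := by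
  classical
  refine ⟨Nat.count (Bends z) r, fun a => ?_⟩
  have h1 := Nat.nth_count ((h.bends_add _).2 (h.bends_bendIndex a))
  have h3 : Nat.count (Bends z) (r + bendIndex z a) = a + Nat.count (Bends z) r := by
    rw [Nat.count_add]
    simp only [h.bends_add]
    rw [bendIndex, Nat.count_nth_of_infinite h.infinite_bends, add_comm]
  rw [h3] at h1
  rw [bendIndex, h1, add_comm]

lemma cumAngle_bend_lt (h : ConvexLoop r z) (a : ℕ) :
    cumAngle z (bendIndex z (a + 1) + 1) < cumAngle z (bendIndex z a + 1) + Real.pi := by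
  have := h.strictMono_bendIndex (lt_add_one a)
  exact h.lt_add_pi (by omega) fun m h1 h2 => h.stepForm_apply_eq_one (by omega) h2

/-- There are at least three bends in a period, because the walk turns by less than `π` from one bend
to the next. -/
lemma three_le (h : ConvexLoop r z) {n : ℕ}
    (hn : ∀ a, bendIndex z (a + n) = bendIndex z a + r) : 3 ≤ n := by
  have h0 := hn 0
  have hp := h.cumAngle_add_period (bendIndex z 0 + 1)
  have hr := h.pos
  have hπ := Real.pi_pos
  rw [show bendIndex z 0 + 1 + r = bendIndex z (0 + n) + 1 by rw [h0]; ring] at hp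
  by_contra! hlt
  have h1 := h.cumAngle_bend_lt 0
  have h2 := h.cumAngle_bend_lt 1
  interval_cases n
  · simp only [add_zero] at h0
    omega
  · simp only [zero_add] at *
    linarith
  · simp only [zero_add, Nat.reduceAdd] at *
    linarith

lemma corner_periodic (h : ConvexLoop r z) {n : ℕ}
    (hn : ∀ a, bendIndex z (a + n) = bendIndex z a + r) :
    Function.Periodic (fun a => z (bendIndex z a + 1)) n := fun a => by
  simp only [hn]
  rw [add_right_comm, h.periodic]

lemma cross_corner_neg (h : ConvexLoop r z) (a : ℕ) :
    cross (z (bendIndex z a + 1)) (z (bendIndex z (a + 1) + 1)) < 0 := by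
  have := h.strictMono_bendIndex (lt_add_one a)
  exact h.cross_neg (h.strictMono (by simpa using this)) (h.cumAngle_bend_lt a)

lemma stepForm_eq_lineForm (h : ConvexLoop r z) (a : ℕ) : stepForm z (bendIndex z (a + 1)) =
    lineForm (z (bendIndex z a + 1)) (z (bendIndex z (a + 1) + 1)) := by
  have := h.strictMono_bendIndex (lt_add_one a)
  exact eq_lineForm (h.cross_corner_neg a).ne (h.stepForm_apply_eq_one (by omega) (by omega))
    (h.stepForm_right _)

/-! ### The convex polygon of a walk -/

/-- The convex polygon whose boundary is the walk, shifted by `p`; its vertices are the bends. -/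
noncomputable def polygon (h : ConvexLoop r z) (p : Plane) (n : ℕ)
    (hn : ∀ a, bendIndex z (a + n) = bendIndex z a + r) : ConvexPolygon where
  n := n
  three_le := h.three_le hn
  vertex i := p + z (bendIndex z i.val + 1)
  convex i j hi hj := by
    have h3 := h.three_le hn
    have : NeZero n := ⟨by omega⟩
    have hper : ∀ a b : ℕ, a % n = b % n →
        z (bendIndex z a + 1) = z (bendIndex z b + 1) := fun a b hab => by
      have h1 := (h.corner_periodic hn).map_mod_nat a
      have h2 := (h.corner_periodic hn).map_mod_nat b
      rw [hab] at h1
      exact h1.symm.trans h2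
    obtain ⟨b, hb1, hb2, hb3⟩ := exists_mod_window (show 0 < n by omega) i.val j.val
    have hbj : (b : ZMod n) = j := by
      rw [← ZMod.natCast_zmod_val j]
      exact (ZMod.natCast_eq_natCast_iff' _ _ _).2 hb3
    have hne : b ≠ i.val := by
      rintro rfl
      exact hi (hbj.symm.trans (ZMod.natCast_zmod_val i))
    have hne' : b ≠ i.val + 1 := by
      rintro rfl
      refine hj (hbj.symm.trans ?_)
      rw [Nat.cast_add, Nat.cast_one, ZMod.natCast_zmod_val]
    have hi1 : z (bendIndex z (i + 1).val + 1) = z (bendIndex z (i.val + 1) + 1) := by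
      apply hper
      rw [← ZMod.natCast_eq_natCast_iff']
      simp
    rw [hi1, hper j.val b hb3.symm, add_sub_add_left_eq_sub, add_sub_add_left_eq_sub,
      cross_sub_eq_lineForm (h.cross_corner_neg _).ne]
    refine mul_neg_of_neg_of_pos (h.cross_corner_neg _) (sub_pos.2 ?_)
    rw [← h.stepForm_eq_lineForm]
    have hlt := h.strictMono_bendIndex (lt_add_one i.val)
    have hlt' := h.strictMono_bendIndex (show i.val + 1 < b by omega)
    have hlt2 := h.strictMono_bendIndex hb2
    rw [hn] at hlt2
    exact h.stepForm_lt_one (h.bends_bendIndex i.val) (h.bends_bendIndex (i.val + 1)) hlt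
      (h.stepForm_eq (by omega) hlt) (by omega) (by omega)

end ConvexLoop

namespace ConvexLoop

variable {r : ℕ} {z : ℕ → Plane} {p : Plane} {n : ℕ}
  (hn : ∀ a, bendIndex z (a + n) = bendIndex z a + r)

lemma polygon_vertex (h : ConvexLoop r z) (a : ℕ) :
    (h.polygon p n hn).vertex (a : ZMod (h.polygon p n hn).n) = p + z (bendIndex z a + 1) := by
  have h1 : z (bendIndex z (a % n) + 1) = z (bendIndex z a + 1) :=
    (h.corner_periodic hn).map_mod_nat a
  rw [← h1, ← ZMod.val_natCast]
  rfl

lemma polygon_edge (h : ConvexLoop r z) (a : ℕ) : (h.polygon p n hn).edge (a : ZMod (h.polygon p n hn).n) =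
    segment ℝ (p + z (bendIndex z a + 1)) (p + z (bendIndex z (a + 1) + 1)) := by
  rw [← h.polygon_vertex hn, ← h.polygon_vertex hn, Nat.cast_add, Nat.cast_one]
  rfl

/-- The points of the walk between two successive bends lie on an edge of the polygon. -/
lemma mem_polygon_edge (h : ConvexLoop r z) {a m : ℕ} (h1 : bendIndex z a < m)
    (h2 : m ≤ bendIndex z (a + 1) + 1) : p + z m ∈ (h.polygon p n hn).edge (a : ZMod (h.polygon p n hn).n) := by
  have hlt := h.strictMono_bendIndex (lt_add_one a)
  obtain ⟨α, β, hα, hβ, he⟩ := h.exists_cone (x := z m) (norm_nonneg _) (h.coord m).1 (h.coord m).2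
    (h.strictMono.monotone (show bendIndex z a + 1 ≤ m by omega)) (h.strictMono.monotone h2)
    (h.strictMono (by omega)) (h.cumAngle_bend_lt a)
  have hf := congrArg (stepForm z (bendIndex z (a + 1))) he
  rw [map_add, map_smul, map_smul, h.stepForm_apply_eq_one h1 h2,
    h.stepForm_apply_eq_one (lt_add_one _) (by omega), h.stepForm_right] at hf
  simp only [smul_eq_mul, mul_one] at hf
  rw [h.polygon_edge hn]
  refine ⟨α, β, hα, hβ, hf.symm, ?_⟩
  rw [he, smul_add, smul_add, add_add_add_comm, ← add_smul, ← hf, one_smul]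

lemma mem_polygon_region (h : ConvexLoop r z) (m : ℕ) : p + z m ∈ (h.polygon p n hn).region := by
  have hper : z (m + (bendIndex z 0 + 1) * r) = z m := by
    have hp : Function.Periodic z r := h.periodic
    simpa using hp.nat_mul (bendIndex z 0 + 1) m
  have hr := h.pos
  have hge : bendIndex z 0 < m + (bendIndex z 0 + 1) * r := by nlinarith
  obtain ⟨a, -, h1, h2⟩ := exists_step (bendIndex z) (m + (bendIndex z 0 + 1) * r - 1)
    (m + (bendIndex z 0 + 1) * r) (by omega)
    (lt_of_lt_of_le (b := m + (bendIndex z 0 + 1) * r) (by omega) h.strictMono_bendIndex.le_apply)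
  rw [← hper]
  exact ConvexPolygon.edge_subset_region _ _ (h.mem_polygon_edge hn (a := a) (by omega) (by omega))

lemma center_mem_polygon_region (h : ConvexLoop r z) : p ∈ (h.polygon p n hn).region := by
  -- the ray opposite to some point of the walk hits a step of the walk
  obtain ⟨m, -, α, β, hα, hβ, he⟩ := h.exists_cone_of_loop (-z 0)
  have hs : 0 < 1 + α + β := by positivity
  have := (h.polygon p n hn).convex_region.sum_mem (t := Finset.univ)
    (w := ![1 / (1 + α + β), α / (1 + α + β), β / (1 + α + β)])
    (z := ![p + z 0, p + z m, p + z (m + 1)])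
    (by intro i _; fin_cases i <;> simp <;> positivity)
    (by simp only [Fin.sum_univ_three, Matrix.cons_val]; field_simp)
    (by intro i _; fin_cases i <;> simp [h.mem_polygon_region hn])
  convert this
  simp only [Fin.sum_univ_three, Matrix.cons_val]
  apply smul_right_injective Plane hs.ne'
  simp only [smul_add, smul_smul, mul_div_cancel₀ _ hs.ne']
  have h0 : z 0 + (α • z m + β • z (m + 1)) = 0 := by rw [← he, add_neg_cancel]
  calc (1 + α + β) • p = (1 + α + β) • p + (z 0 + (α • z m + β • z (m + 1))) := by
        rw [h0, add_zero]
    _ = _ := by module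

lemma stepForm_le_one_of_mem_region (h : ConvexLoop r z) (m : ℕ) {x : Plane}
    (hx : x ∈ (h.polygon p n hn).region) : stepForm z m (x - p) ≤ 1 := by
  have hc : Convex ℝ {x | stepForm z m (x - p) ≤ 1} := by
    simp only [map_sub, sub_le_iff_le_add]
    exact convex_halfSpace_le (stepForm z m).isLinear _
  refine convexHull_min ?_ hc hx
  rintro _ ⟨i, rfl⟩
  simp only [polygon, Set.mem_ofPred_eq, add_sub_cancel_left]
  exact h.stepForm_le_one _ _

/-- Interior points of the polygon are not on the lines of the walk: moving such a point slightly
away from `p` would leave the polygon. -/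
lemma stepForm_ne_one_of_mem_interior (h : ConvexLoop r z) (m : ℕ) {x : Plane}
    (hx : x ∈ interior (h.polygon p n hn).region) : stepForm z m (x - p) ≠ 1 := by
  intro h1
  have hcont : Continuous fun ε : ℝ => x + ε • (x - p) := by fun_prop
  have hev : ∀ᶠ ε in nhds (0 : ℝ), x + ε • (x - p) ∈ interior (h.polygon p n hn).region :=
    hcont.continuousAt.eventually_mem (isOpen_interior.mem_nhds (by simpa using hx))
  obtain ⟨ε, hε, hε0⟩ := ((hev.filter_mono nhdsWithin_le_nhds).and
    (self_mem_nhdsWithin : ∀ᶠ ε in nhdsWithin (0 : ℝ) (Set.Ioi 0), ε ∈ Set.Ioi 0)).exists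
  have := h.stepForm_le_one_of_mem_region hn m (interior_subset hε)
  rw [add_sub_right_comm, map_add, map_smul, h1, smul_eq_mul, mul_one] at this
  have hε0' : 0 < ε := hε0
  linarith

/-- A point of the polygon lies in one of the triangles spanned by `p` and a step. -/
lemma exists_triangle_of_mem_region (h : ConvexLoop r z) {x : Plane}
    (hx : x ∈ (h.polygon p n hn).region) :
    ∃ m < r, x ∈ convexHull ℝ {p, p + z m, p + z (m + 1)} := by
  obtain ⟨m, hm, α, β, hα, hβ, hab, he⟩ := h.exists_triangle fun m _ =>
    h.stepForm_le_one_of_mem_region hn m hx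
  refine ⟨m, hm, mem_triangle (p := p) hα hβ hab (a := p + z m) (b := p + z (m + 1)) (by simpa using he)
    (convex_convexHull ℝ _) ?_ ?_ ?_⟩ <;> exact subset_convexHull ℝ _ (by simp)

end ConvexLoop

/-! ### The polygon of a cycle of length `2π` -/

section Cycle

variable {S S' : Finset Plane} {ℋ : Finset HalfPlane} {p : Plane} {k r : ℕ}
  {v : ℕ → Vert S S' ℋ p k}

lemma IsDirectedCycle.cycleSeg_eq (hv : IsDirectedCycle (chainGraph S S' ℋ p k) r v) (hk : 1 ≤ k)
    (m : ℕ) : cycleSeg r v m = ⟨p + cyclePoint r v m, p + cyclePoint r v (m + 1)⟩ := by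
  ext1
  · exact (add_sub_cancel p _).symm
  · exact (hv.right_eq hk m).trans (add_sub_cancel p _).symm

lemma IsDirectedCycle.convexLoop (hv : IsDirectedCycle (chainGraph S S' ℋ p k) r v) (hk : 1 ≤ k)
    (hL : ∑ i ∈ Finset.range r, weight (v i) (v (i + 1)) = 2 * Real.pi) :
    ConvexLoop r (cyclePoint r v) where
  toClockwiseLoop := hv.clockwiseLoop hk
  full := by rw [← hv.sum_weight, hL]
  bend m := by
    have h := hv.cross_dir_nonpos hk m
    rw [hv.cycleSeg_eq hk, hv.cycleSeg_eq hk] at h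
    simpa only [Seg.dir, add_sub_add_left_eq_sub] using h

variable {n : ℕ}
  (hn : ∀ a, bendIndex (cyclePoint r v) (a + n) = bendIndex (cyclePoint r v) a + r)

lemma IsDirectedCycle.polygon_compatible (hv : IsDirectedCycle (chainGraph S S' ℋ p k) r v)
    (hk : 1 ≤ k) (hp : ∀ H ∈ ℋ, p ∉ H.carrier) (h : ConvexLoop r (cyclePoint r v)) :
    (h.polygon p n hn).Compatible ℋ := by
  intro i
  have : NeZero n := ⟨by have := h.three_le hn; omega⟩
  obtain ⟨a, rfl⟩ : ∃ a : ℕ, i = (a : ZMod (h.polygon p n hn).n) := ⟨i.val, (ZMod.natCast_zmod_val i).symm⟩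
  set m := bendIndex (cyclePoint r v) (a + 1) with hm
  obtain ⟨⟨_, ⟨H, hH, rfl⟩, ⟨_, -, h1⟩, _, -, h2⟩, -⟩ :=
    IsDirectedCycle.cycleSeg_mem (r := r) (v := v) m
  have h1 : _ ∈ H.line := (h1.ge rfl).1
  have h2 : _ ∈ H.line := (h2.ge rfl).1
  rw [hv.cycleSeg_eq hk] at h1 h2
  have hlt := h.strictMono_bendIndex (lt_add_one a)
  refine ⟨H, ConvexPolygon.isEdgeHalfplane hH ?_ (hp H hH) (h.center_mem_polygon_region hn)⟩
  rw [h.polygon_edge hn]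
  refine H.convex_line.segment_subset ?_ h2
  refine HalfPlane.mem_line_of_lineForm_eq_one (p := p) h1 h2 ?_ ?_
  · simpa using (h.turn m).ne
  · simpa using h.stepForm_apply_eq_one (lt_add_one _) (by omega)

lemma IsDirectedCycle.polygon_wellBehaved (hv : IsDirectedCycle (chainGraph S S' ℋ p k) r v)
    (hk : 1 ≤ k) (h : ConvexLoop r (cyclePoint r v)) :
    (h.polygon p n hn).WellBehaved S S' ℋ k := by
  have hC : ∀ m (j : Fin (k + 1)), (v (m % r)).1 j =
      ⟨p + cyclePoint r v (m + j), p + cyclePoint r v (m + j + 1)⟩ := fun m j => by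
    rw [← hv.cycleSeg_eq hk]
    exact hv.apply_eq j j.2 m
  constructor
  · intro s hs hsi
    obtain ⟨m, -, hm⟩ := h.exists_triangle_of_mem_region hn (interior_subset hsi)
    have hU : s ∈ ⋃ j, ((v (m % r)).1 j).triangle p := by
      refine Set.mem_iUnion.2 ⟨0, ?_⟩
      rw [hC]
      exact hm
    obtain ⟨j, hj⟩ := Set.mem_iUnion.1 ((v (m % r)).2.coverage ⟨hs, hU⟩)
    rw [hC] at hj
    obtain ⟨α, β, -, -, hab, rfl⟩ := hj
    refine h.stepForm_ne_one_of_mem_interior hn (m + j) hsi ?_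
    have : α • (p + cyclePoint r v (m + j)) + β • (p + cyclePoint r v (m + j + 1)) - p =
        α • cyclePoint r v (m + j) + β • cyclePoint r v (m + j + 1) := by
      rw [smul_add, smul_add, add_add_add_comm, ← add_smul, hab, one_smul, add_sub_cancel_left]
    rw [this, map_add, map_smul, map_smul, h.stepForm_left, h.stepForm_right]
    simpa using hab
  · intro i H hH
    have : NeZero n := ⟨by have := h.three_le hn; omega⟩
    obtain ⟨a, rfl⟩ : ∃ a : ℕ, i = (a : ZMod (h.polygon p n hn).n) := ⟨i.val, (ZMod.natCast_zmod_val i).symm⟩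
    -- the chain begins with the last segment in the first edge, so that its `k + 1` segments lie
    -- in the given `k + 1` edges
    set m := bendIndex (cyclePoint r v) (a + 1) with hm
    have hlt : bendIndex (cyclePoint r v) a < m := h.strictMono_bendIndex (lt_add_one a)
    have hstep : ∀ j : Fin (k + 1), ∃ σ : Fin (k + 1),
        ((v (m % r)).1 j).carrier ⊆ (h.polygon p n hn).edge (a + (σ : ℕ)) := by
      intro j
      have hle := h.strictMono_bendIndex.add_le_nat j (a + 1)
      obtain ⟨σ, hσ, h1, h2⟩ := exists_step (fun c => bendIndex (cyclePoint r v) (a + c))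
        (m + j - 1) (j + 1) (by simp only [add_zero]; omega)
        (by rw [show a + ((j : ℕ) + 1) = j + (a + 1) by ring]; omega)
      refine ⟨⟨σ, by omega⟩, ?_⟩
      rw [hC, ← Nat.cast_add]
      rw [← add_assoc] at h2
      exact (convex_segment _ _).segment_subset
        (h.mem_polygon_edge hn (a := a + σ) (by omega) (by omega))
        (h.mem_polygon_edge hn (a := a + σ) (by omega) (by omega))
    choose σ hσ using hstep
    have hmem := (v (m % r)).2.membership (fun j => H (σ j)) fun j =>
      ⟨(hH (σ j)).1, (hσ j).trans (hH (σ j)).2.1⟩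
    refine Set.subset_eq_empty (Set.inter_subset_inter_left _ ?_) hmem
    exact Set.subset_iInter fun j => Set.iInter_subset _ (σ j)

end Cycle

end HalfplaneCover

theorem mainTheorem5 (S S' : Finset HalfplaneCover.Plane)
    (ℋ : Finset HalfplaneCover.HalfPlane) (k : ℕ) (hk : 1 ≤ k) (p : HalfplaneCover.Plane)
    (hp : ∀ H ∈ ℋ, p ∉ H.carrier) :
    (∃ Γ : HalfplaneCover.ConvexPolygon,
        Γ.Compatible ℋ ∧ Γ.WellBehaved S S' ℋ k ∧ p ∈ Γ.region) ↔
      IsLeast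
        (HalfplaneCover.cycleLengths (HalfplaneCover.chainGraph S S' ℋ p k)
          HalfplaneCover.weight)
        (2 * Real.pi) := by
  constructor
  · rintro ⟨Γ, hΓ, hw, hpΓ⟩
    exact ⟨hw.two_pi_mem_cycleLengths hΓ hp hpΓ,
      fun L hL => HalfplaneCover.two_pi_le_of_mem_cycleLengths hk hL⟩
  · rintro ⟨⟨r, v, hv, hL⟩, -⟩
    have h := hv.convexLoop hk hL.symm
    obtain ⟨n, hn⟩ := h.exists_bendIndex_add
    exact ⟨h.polygon p n hn, hv.polygon_compatible hn hk hp h, hv.polygon_wellBehaved hn hk h,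
      h.center_mem_polygon_region hn⟩
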